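/- For every integer $d\ge 3$ there is an essentially free probability measure preserving action of the free product $\Gamma=(\mathbb{Z}/2\mathbb{Z})^{*d}$ on a standard Borel probability space $(X,\lambda)$ with the following properties. Let $s_1,\dots,s_d$ be the standard generators of $\Gamma$, let $\mathcal G$ be the Schreier graphing on $X$ (distinct points $x,y$ are adjacent if and only if $y=s_ix$ for some $i$), let $E(\mathcal G)$ be its set of directed edges (containing both directions of each edge), and let $\eta(S)=\frac1d\int_X\deg_S(x)\,d\lambda(x)$ for measurable $S\subseteq E(\mathcal G)$, where $\deg_S(x)$ is the number of edges in $S$ leaving $x$. All properties are understood up to null sets. 1. $\mathcal G$ is measurably bipartite: there is a measurable $B\subseteq X$ such that every edge joins $B$ and $X\setminus B$. 2. A circulation is an antisymmetric function $f:E(\mathcal G)\to\mathbb{R}$ with $\sum_{y:(x,y)\in E(\mathcal G)}f(x,y)=0$ for every $x$. For a suitable $B$ as in 1, and for $i=1,\dots,d$, let $\alpha_i$ be the antisymmetric function such that, for $(x,y)\in E(\mathcal G)$ with $x\in B$, $\alpha_i(x,y)=1$ if $y=s_ix$ and $\alpha_i(x,y)=-\frac1{d-1}$ otherwise. Then $\alpha_1,\dots,\alpha_d$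 are circulations in $L^2(E(\mathcal G),\eta)$, and every circulation in $L^2(E(\mathcal G),\eta)$ is a real linear combination of them. 3. $\mathcal G$ has exactly $d$ measurable perfect matchings, namely the color classes $\{(x,s_ix):x\in X\}$ of the generators, $i=1,\dots,d$: these are pairwise distinct measurable perfect matchings, and every measurable perfect matching coincides with one of them. -/

import Mathlib

open MeasureTheory
open scoped ENNReal

/-- The free product `(ℤ/2ℤ)^{*d}` of `d` copies of the two-element group. -/
abbrev FreeProdZ2 (d : ℕ) : Type :=
  Monoid.CoprodI (fun _ : Fin d => Multiplicative (ZMod 2))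

/-- The `i`-th standard generator: the nontrivial element of the `i`-th factor. -/
def FreeProdZ2.gen {d : ℕ} (i : Fin d) : FreeProdZ2 d :=
  Monoid.CoprodI.of (M := fun _ : Fin d => Multiplicative (ZMod 2)) (i := i)
    (Multiplicative.ofAdd (1 : ZMod 2))

/-- The action of the (countable) group `G` on `(X, μ)` is probability measure preserving and
essentially free: almost every point has trivial stabilizer. -/
structure IsEssFreePMPAction (G : Type*) [Group G] {X : Type*} [MeasurableSpace X]
    [MulAction G X] (μ : Measure X) : Prop where
  isProbabilityMeasure : IsProbabilityMeasure μ
  measurePreserving : ∀ g : G, MeasurePreserving (fun x : X => g • x) μ μ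
  essentially_free : ∀ᵐ x ∂μ, ∀ g : G, g • x = x → g = 1

/-- The Schreier graph of an action with respect to a family `s` of elements of the group. -/
def schreierGraph {G : Type*} [Group G] {ι : Type*} (s : ι → G) (X : Type*) [MulAction G X] :
    SimpleGraph X where
  Adj x y := x ≠ y ∧ ∃ i, y = s i • x ∨ x = s i • y
  symm := ⟨fun _ _ h => ⟨h.1.symm, h.2.imp fun _ => Or.symm⟩⟩
  loopless := ⟨fun _ h => h.1 rfl⟩

/-- `B` and its complement are the two classes of a measurable bipartition of `Γ`,
up to a null set. -/
def IsMeasurableBipartition {X : Type*} [MeasurableSpace X] (Γ : SimpleGraph X) (μ : Measure X)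
    (B : Set X) : Prop :=
  MeasurableSet B ∧ ∀ᵐ x ∂μ, ∀ y, Γ.Adj x y → (x ∈ B ↔ y ∉ B)

/-- `M`, a measurable symmetric set of (directed) edges of `Γ`, is a measurable perfect matching:
almost every vertex is incident to exactly one edge in `M`. -/
structure IsMeasurablePerfectMatching {X : Type*} [MeasurableSpace X] (Γ : SimpleGraph X)
    (μ : Measure X) (M : Set (X × X)) : Prop where
  measurableSet : MeasurableSet M
  subset_edges : ∀ x y, (x, y) ∈ M → Γ.Adj x y
  symm : ∀ x y, (x, y) ∈ M → (y, x) ∈ M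
  perfect : ∀ᵐ x ∂μ, ∃! y, (x, y) ∈ M

/-- `f`, regarded as a function on the directed edges of the locally finite graph `Γ`, is a
circulation in `L²` of the edge measure `η`: it is square integrable, and up to a null set of
vertices it is antisymmetric and its sum over the edges leaving a vertex vanishes. -/
structure IsL2Circulation {X : Type*} [MeasurableSpace X] (Γ : SimpleGraph X)
    (μ : Measure X) (η : Measure (X × X)) (f : X × X → ℝ) : Prop where
  memLp : MemLp f 2 η
  antisymm : ∀ᵐ x ∂μ, ∀ y, Γ.Adj x y → f (y, x) = -f (x, y)
  flow : ∀ᵐ x ∂μ, ∑ᶠ y ∈ Γ.neighborSet x, f (x, y) = 0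

namespace FreeProdZ2

variable {d : ℕ} {X : Type*} [MulAction (FreeProdZ2 d) X]

/-- The Schreier graph of an action of `(ℤ/2ℤ)^{*d}` with respect to its standard generators. -/
def graph (d : ℕ) (X : Type*) [MulAction (FreeProdZ2 d) X] : SimpleGraph X :=
  schreierGraph (gen : Fin d → FreeProdZ2 d) X

/-- The color class of the `i`-th generator: the directed edges `(x, gen i • x)`. -/
def colorClass (X : Type*) [MulAction (FreeProdZ2 d) X] (i : Fin d) : Set (X × X) :=
  {p | p.1 ≠ p.2 ∧ p.2 = (gen i : FreeProdZ2 d) • p.1}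

/-- The normalized edge measure on directed edges: every vertex contributes its `d` outgoing
edges, with total weight `1`. See `edgeMeasure_apply` for the description by degrees. -/
noncomputable def edgeMeasure [MeasurableSpace X] (d : ℕ) [MulAction (FreeProdZ2 d) X]
    (μ : Measure X) : Measure (X × X) :=
  (d : ℝ≥0∞)⁻¹ • ∑ i : Fin d, μ.map (fun x => (x, (gen i : FreeProdZ2 d) • x))

open Classical in
/-- The circulation of the `i`-th generator, for a bipartition with classes `B` and `Bᶜ`: an edge
directed from `B` to `Bᶜ` gets the value `1` if it has color `i`, and `-1/(d-1)` if it has another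
color; an edge directed from `Bᶜ` to `B` gets the negative of this value. -/
noncomputable def genCirculation (B : Set X) (i : Fin d) (p : X × X) : ℝ :=
  (if p.1 ∈ B then 1 else -1) * (if p ∈ colorClass X i then 1 else -1 / ((d : ℝ) - 1))

theorem gen_ne_one (i : Fin d) : (gen i : FreeProdZ2 d) ≠ 1 := by
  intro h
  have h2 := Monoid.CoprodI.of_injective (M := fun _ : Fin d => Multiplicative (ZMod 2)) i
    (h.trans (map_one _).symm)
  exact absurd h2 (by decide)

theorem gen_mul_self (i : Fin d) : (gen i : FreeProdZ2 d) * gen i = 1 := by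
  unfold gen
  rw [← map_mul]
  exact (congrArg _ (by decide)).trans (map_one _)

theorem gen_injective : Function.Injective (gen : Fin d → FreeProdZ2 d) := by
  intro i j h
  by_contra hij
  let M := fun _ : Fin d => Multiplicative (ZMod 2)
  have h2 := congrArg
    (Monoid.CoprodI.lift (Pi.mulSingle (M := fun k => M k →* M i) i (MonoidHom.id (M i)))) h
  unfold gen at h2
  rw [Monoid.CoprodI.lift_of, Monoid.CoprodI.lift_of, Pi.mulSingle_eq_same,
    Pi.mulSingle_eq_of_ne (Ne.symm hij)] at h2
  exact absurd h2 (by decide)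

theorem graph_adj {x y : X} :
    (graph d X).Adj x y ↔ x ≠ y ∧ ∃ i : Fin d, y = (gen i : FreeProdZ2 d) • x := by
  refine and_congr_right fun _ => exists_congr fun i => or_iff_left_of_imp fun h => ?_
  rw [h, smul_smul, gen_mul_self, one_smul]

/-- For essentially free pmp actions, `edgeMeasure` is the usual edge measure: the measure of a
set `S` of directed edges is `1/d` times the integral of the number of edges in `S` leaving `x`. -/
theorem edgeMeasure_apply [MeasurableSpace X] {μ : Measure X}
    (h : IsEssFreePMPAction (FreeProdZ2 d) μ) {S : Set (X × X)} (hS : MeasurableSet S) :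
    edgeMeasure d μ S =
      (d : ℝ≥0∞)⁻¹ * ∫⁻ x, ({y | (graph d X).Adj x y ∧ (x, y) ∈ S}.encard : ℝ≥0∞) ∂μ := by
  classical
  have hm : ∀ i : Fin d, Measurable (fun x : X => (x, (gen i : FreeProdZ2 d) • x)) := fun i =>
    measurable_id.prodMk (h.measurePreserving _).measurable
  simp only [edgeMeasure, Measure.smul_apply, Measure.finsetSum_apply, smul_eq_mul]
  congr 1
  have h1 : ∀ i : Fin d, μ.map (fun x => (x, (gen i : FreeProdZ2 d) • x)) S =
      ∫⁻ x, ((fun x : X => (x, (gen i : FreeProdZ2 d) • x)) ⁻¹' S).indicator 1 x ∂μ := fun i => by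
    rw [Measure.map_apply (hm i) hS, lintegral_indicator_one (hm i hS)]
  rw [Finset.sum_congr rfl fun i _ => h1 i, ← lintegral_finsetSum]
  · refine lintegral_congr_ae (h.essentially_free.mono fun x hx => ?_)
    have hinj : Function.Injective (fun i : Fin d => (gen i : FreeProdZ2 d) • x) := by
      intro i j hij
      refine gen_injective (inv_mul_eq_one.mp (hx ((gen i)⁻¹ * gen j) ?_))
      rw [mul_smul, inv_smul_eq_iff]
      exact hij.symm
    have hset : {y | (graph d X).Adj x y ∧ (x, y) ∈ S} =
        (fun i : Fin d => (gen i : FreeProdZ2 d) • x) ''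
          (Finset.univ.filter fun i : Fin d => (x, (gen i : FreeProdZ2 d) • x) ∈ S) := by
      ext y
      simp only [graph_adj, Set.mem_ofPred_eq, Set.mem_image, Finset.coe_filter, Finset.mem_univ,
        true_and]
      constructor
      · rintro ⟨⟨_, i, rfl⟩, hi⟩
        exact ⟨i, hi, rfl⟩
      · rintro ⟨i, hi, rfl⟩
        exact ⟨⟨fun hh => gen_ne_one i (hx _ hh.symm), i, rfl⟩, hi⟩
    simp only [hset, hinj.encard_image, Set.encard_coe_eq_coe_finsetCard]
    simp [Set.indicator_apply, Finset.sum_boole]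
  · exact fun i _ => measurable_one.indicator (hm i hS)

end FreeProdZ2

/-! A circulation with values `F i x` on the edges from x to `S i x` is orthogonal to every bounded
gradient `h (S i x) - h x`. The involutions `S i` are built so that for every color i and any two
distinct cylinders of equal order inside `side`, the difference of their indicators, placed on the
edges of color i and extended by zero to the other colors, is an L² limit of gradients
(`exists_involutions`). Hence `F i` has equal integrals over the two cylinders, so it is constant on
`side` (`IsSystem.exists_const`) and the opposite constant on the other side. What remains is d
constants with sum zero, and the circulations of the generators span these.

Every involution starts as `flip`, which interchanges the sides, and is conjugated once per stage.
At stage n one color is conjugated by a shift, which raises the still untouched coordinate n + 1 by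
one on one cylinder and lowers it by one on another. Taken as a potential, this coordinate then has
the prescribed gradient along that color and gradient zero along the others, except where it is
extremal. Later stages disturb this only on a set of measure at most 8 / `size (n + 2)`, that is 8 /
`size (n + 1)` ^ 3, which is small even against the square of the potential. The same estimate makes
the stages converge almost everywhere.

Freeness comes from this rigidity (`IsSystem.ae_walk_ne`): if a reduced word fixed a set of positive
measure, a unit flow along the closed walks from a small part of that set would be a nonzero
circulation with small support. For a perfect matching, its indicator minus 1/d, with the sign of
the side, is a circulation; so membership of an edge depends on its color alone. -/

namespace Tower

/-! ### The sequence space, its cylinders and its measure -/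

/-- The number of values of the `n`-th coordinate of a point of `Seq`. -/
def size (n : ℕ) : ℕ := 2 ^ 3 ^ n

theorem size_pos (n : ℕ) : 0 < size n := by unfold size; positivity

instance (n : ℕ) : NeZero (size n) := ⟨(size_pos n).ne'⟩

/-- Sequences whose `n`-th term lies in a set with `size n` elements. -/
abbrev Seq : Type := ∀ n, Fin (size n)

/-- `x` and `y` agree in the coordinates up to `n`. -/
def Agree (n : ℕ) (x y : Seq) : Prop := ∀ k ≤ n, x k = y k

theorem Agree.refl (n : ℕ) (x : Seq) : Agree n x x := fun _ _ => rfl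

theorem Agree.symm {n : ℕ} {x y : Seq} (h : Agree n x y) : Agree n y x :=
  fun k hk => (h k hk).symm

theorem Agree.trans {n : ℕ} {x y z : Seq} (h : Agree n x y) (h' : Agree n y z) : Agree n x z :=
  fun k hk => (h k hk).trans (h' k hk)

theorem Agree.mono {m n : ℕ} (hmn : m ≤ n) {x y : Seq} (h : Agree n x y) : Agree m x y :=
  fun k hk => h k (hk.trans hmn)

theorem agree_succ {n : ℕ} {x y : Seq} :
    Agree (n + 1) x y ↔ Agree n x y ∧ x (n + 1) = y (n + 1) := by
  refine ⟨fun h => ⟨h.mono n.le_succ, h _ le_rfl⟩, fun h k hk => ?_⟩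
  rcases Nat.le_succ_iff.mp hk with hk | rfl
  exacts [h.1 k hk, h.2]

/-- The set of the points which agree with `x` up to `n`. -/
def cyl (n : ℕ) (x : Seq) : Set Seq := {y | Agree n y x}

theorem mem_cyl {n : ℕ} {x y : Seq} : y ∈ cyl n x ↔ Agree n y x := Iff.rfl

theorem cyl_eq_of_agree {n : ℕ} {x y : Seq} (h : Agree n x y) : cyl n x = cyl n y :=
  Set.ext fun _ => ⟨fun hz => Agree.trans hz h, fun hz => Agree.trans hz h.symm⟩

theorem cyl_eq_pi (n : ℕ) (x : Seq) :
    cyl n x = Set.pi (Finset.range (n + 1)) (fun k => {x k}) := by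
  ext y
  simp [mem_cyl, Agree]

theorem measurableSet_cyl (n : ℕ) (x : Seq) : MeasurableSet (cyl n x) := by
  rw [cyl_eq_pi]
  exact MeasurableSet.pi (Finset.countable_toSet _) fun _ _ => measurableSet_singleton _

/-- Initial segments of sequences. -/
abbrev Word (n : ℕ) : Type := ∀ k : Fin (n + 1), Fin (size k)

/-- A sequence with a given initial segment. -/
def Word.extend {n : ℕ} (p : Word n) : Seq :=
  fun k => if h : k < n + 1 then p ⟨k, h⟩ else 0

theorem exists_word (n : ℕ) (x : Seq) : ∃ p : Word n, Agree n p.extend x := by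
  refine ⟨fun k => x k, fun k hk => ?_⟩
  simp [Word.extend, hk]

/-- Cylinder sets of order at least `m`, together with the empty set. -/
def cylSets (m : ℕ) : Set (Set Seq) := {s | s = ∅ ∨ ∃ n x, m ≤ n ∧ s = cyl n x}

theorem isPiSystem_cylSets (m : ℕ) : IsPiSystem (cylSets m) := by
  have key : ∀ {n n' : ℕ} {x x' : Seq}, n ≤ n' → (cyl n x ∩ cyl n' x').Nonempty →
      cyl n x ∩ cyl n' x' = cyl n' x' := by
    rintro n n' x x' hn ⟨y, hy, hy'⟩
    refine Set.inter_eq_right.mpr fun z hz => ?_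
    exact ((Agree.trans hz (Agree.symm hy')).mono hn).trans hy
  rintro _ (rfl | ⟨n, x, hn, rfl⟩) _ (rfl | ⟨n', x', hn', rfl⟩) hne
  · simp at hne
  · simp at hne
  · simp at hne
  · rcases le_total n n' with h | h
    · rw [key h hne]; exact Or.inr ⟨n', x', hn', rfl⟩
    · rw [Set.inter_comm] at hne ⊢
      rw [key h hne]; exact Or.inr ⟨n, x, hn, rfl⟩

/-- A condition on coordinate k is a finite union of cylinders of order `max m k`, so small orders
can be dropped. This matters because a local permutation is controlled only from some order on. -/
theorem generateFrom_cylSets (m : ℕ) :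
    (MeasurableSpace.pi : MeasurableSpace Seq) = MeasurableSpace.generateFrom (cylSets m) := by
  apply le_antisymm
  · refine iSup_le fun k => ?_
    rw [← measurable_iff_comap_le]
    let _ : MeasurableSpace Seq := MeasurableSpace.generateFrom (cylSets m)
    refine measurable_to_countable' fun a => ?_
    have : (fun x : Seq => x k) ⁻¹' {a} =
        ⋃ p ∈ {p : Word (max m k) | p.extend k = a}, cyl (max m k) p.extend := by
      ext x
      simp only [Set.mem_preimage, Set.mem_singleton_iff, Set.mem_iUnion, mem_cyl, exists_prop]
      constructor
      · rintro rfl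
        obtain ⟨p, hp⟩ := exists_word (max m k) x
        exact ⟨p, hp k (le_max_right _ _), hp.symm⟩
      · rintro ⟨p, hp, hx⟩
        exact (hx k (le_max_right _ _)).trans hp
    rw [this]
    exact MeasurableSet.biUnion (Set.to_countable _) fun p _ =>
      MeasurableSpace.measurableSet_generateFrom (Or.inr ⟨_, _, le_max_left _ _, rfl⟩)
  · refine MeasurableSpace.generateFrom_le ?_
    rintro _ (rfl | ⟨n, x, -, rfl⟩)
    exacts [MeasurableSet.empty, measurableSet_cyl n x]

/-- The product of the uniform measures. -/
noncomputable def mu : Measure Seq :=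
  Measure.infinitePi fun n => (ProbabilityTheory.uniformOn Set.univ : Measure (Fin (size n)))

instance : IsProbabilityMeasure mu := by unfold mu; infer_instance

/-- The measure of the cylinder sets of order `n`. -/
noncomputable def mass (n : ℕ) : ℝ≥0∞ := ∏ k ∈ Finset.range (n + 1), (size k : ℝ≥0∞)⁻¹

theorem uniformOn_singleton_fin (n : ℕ) (a : Fin (size n)) :
    (ProbabilityTheory.uniformOn Set.univ : Measure (Fin (size n))) {a} = (size n : ℝ≥0∞)⁻¹ := by
  rw [ProbabilityTheory.uniformOn_univ]
  simp

theorem mu_cyl (n : ℕ) (x : Seq) : mu (cyl n x) = mass n := by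
  rw [cyl_eq_pi, mu, Measure.infinitePi_pi _ fun _ _ => measurableSet_singleton _]
  exact Finset.prod_congr rfl fun k _ => uniformOn_singleton_fin k _

theorem mu_coord (k : ℕ) (a : Fin (size k)) : mu {x | x k = a} = (size k : ℝ≥0∞)⁻¹ := by
  have : {x : Seq | x k = a} =
      Set.pi ({k} : Finset ℕ) (fun j => if h : j = k then {h ▸ a} else Set.univ) := by
    ext x
    simp
  rw [this, mu, Measure.infinitePi_pi]
  · simp [uniformOn_singleton_fin]
  · intro i hi
    obtain rfl := Finset.mem_singleton.mp hi
    simp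

theorem measurableSet_coord (k : ℕ) (a : Fin (size k)) : MeasurableSet {x : Seq | x k = a} :=
  (measurable_pi_apply k : Measurable fun x : Seq => x k) (measurableSet_singleton a)

theorem mass_succ (n : ℕ) : mass (n + 1) = mass n * (size (n + 1) : ℝ≥0∞)⁻¹ :=
  Finset.prod_range_succ _ _

theorem mass_pos (n : ℕ) : mass n ≠ 0 :=
  Finset.prod_ne_zero_iff.mpr fun _ _ => by simp

theorem one_le_size (n : ℕ) : 1 ≤ size n := size_pos n

/-- The cubic growth is what lets an error set of measure of order 1 / `size (n + 1)` absorb the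
square of a potential bounded by `size n`. -/
theorem size_succ (n : ℕ) : size (n + 1) = size n ^ 3 := by
  rw [size, size, ← pow_mul, pow_succ]

theorem two_pow_le_size (n : ℕ) : 2 ^ n ≤ size n :=
  Nat.pow_le_pow_right (by norm_num) (Nat.lt_pow_self (by norm_num : 1 < 3)).le

theorem two_mul_size_le (n : ℕ) : 2 * size n ≤ size (n + 1) := by
  rw [size_succ]
  have h : 2 ≤ size n := by
    calc 2 = 2 ^ 1 := by norm_num
      _ ≤ _ := Nat.pow_le_pow_right (by norm_num) (Nat.one_le_pow _ _ (by norm_num))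
  nlinarith [Nat.mul_le_mul h h, Nat.mul_le_mul (Nat.mul_le_mul h h) h]

theorem mass_le (n : ℕ) : mass n ≤ (2 ^ n : ℝ≥0∞)⁻¹ := by
  obtain _ | n := n
  · simp [mass, size]
  rw [mass_succ]
  refine (mul_le_of_le_one_left (by simp) ?_).trans (ENNReal.inv_le_inv.mpr ?_)
  · exact Finset.prod_le_one (fun _ _ => by simp) fun k _ => by
      simpa using one_le_size k
  · exact_mod_cast two_pow_le_size (n + 1)

theorem measurePreserving_of_cyl {f : Seq → Seq} (hf : Measurable f) (m : ℕ)
    (h : ∀ n, m ≤ n → ∀ x, mu (f ⁻¹' cyl n x) = mass n) : MeasurePreserving f mu mu := by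
  have : IsProbabilityMeasure (mu.map f) := Measure.isProbabilityMeasure_map hf.aemeasurable
  refine ⟨hf, ext_of_generate_finite (cylSets m) (generateFrom_cylSets m) (isPiSystem_cylSets m)
    ?_ (by simp)⟩
  rintro _ (rfl | ⟨n, x, hn, rfl⟩)
  · simp
  · rw [Measure.map_apply hf (measurableSet_cyl n x), h n hn, mu_cyl]

/-! ### Permutations acting on initial segments -/

/-- A permutation of `Seq` which acts on the initial segments of length at least `m`. -/
def IsLocal (m : ℕ) (e : Equiv.Perm Seq) : Prop :=
  ∀ n, m ≤ n → ∀ x y, Agree n x y ↔ Agree n (e x) (e y)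

theorem IsLocal.mono {m n : ℕ} (hmn : m ≤ n) {e : Equiv.Perm Seq} (h : IsLocal m e) :
    IsLocal n e := fun k hk => h k (hmn.trans hk)

theorem IsLocal.mul {m : ℕ} {e e' : Equiv.Perm Seq} (h : IsLocal m e) (h' : IsLocal m e') :
    IsLocal m (e * e') := fun n hn x y => (h' n hn x y).trans (h n hn _ _)

theorem IsLocal.preimage_cyl {m : ℕ} {e : Equiv.Perm Seq} (h : IsLocal m e) {n : ℕ} (hn : m ≤ n)
    (x : Seq) : e ⁻¹' cyl n x = cyl n (e.symm x) := by
  ext y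
  rw [Set.mem_preimage, mem_cyl, mem_cyl, h n hn y, Equiv.apply_symm_apply]

theorem IsLocal.measurable {m : ℕ} {e : Equiv.Perm Seq} (h : IsLocal m e) : Measurable e := by
  rw [measurable_iff_comap_le]
  nth_rw 1 [generateFrom_cylSets m]
  rw [← measurable_iff_comap_le]
  refine measurable_generateFrom ?_
  rintro _ (rfl | ⟨n, x, hn, rfl⟩)
  · exact MeasurableSet.empty
  · rw [h.preimage_cyl hn]
    exact measurableSet_cyl _ _

theorem IsLocal.measurePreserving {m : ℕ} {e : Equiv.Perm Seq} (h : IsLocal m e) :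
    MeasurePreserving e mu mu :=
  measurePreserving_of_cyl h.measurable m fun n hn x => by rw [h.preimage_cyl hn, mu_cyl]

/-- The involution which changes the first coordinate. -/
def flip : Equiv.Perm Seq :=
  Function.Involutive.toPerm (fun x => Function.update x 0 (x 0).rev) fun x => by simp

theorem flip_zero (x : Seq) : flip x 0 = (x 0).rev := by
  simp [flip, Function.Involutive.toPerm]

theorem flip_of_pos (x : Seq) {k : ℕ} (hk : 0 < k) : flip x k = x k := by
  simp [flip, Function.Involutive.toPerm, Function.update_of_ne hk.ne']

theorem flip_flip (x : Seq) : flip (flip x) = x :=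
  Function.Involutive.toPerm_involutive (f := fun x : Seq => Function.update x 0 (x 0).rev) _ x

theorem flip_agree {n : ℕ} {x y : Seq} (h : Agree n x y) : Agree n (flip x) (flip y) := by
  intro k hk
  obtain rfl | hk' := k.eq_zero_or_pos
  · rw [flip_zero, flip_zero, h 0 hk]
  · rw [flip_of_pos x hk', flip_of_pos y hk', h k hk]

theorem isLocal_flip : IsLocal 0 flip := fun n _ x y =>
  ⟨flip_agree, fun h => by simpa only [flip_flip] using flip_agree h⟩

/-! ### Shifts of one coordinate -/

/-- The sequence obtained from `x` by replacing the coordinates up to `m` by those of `w`. -/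
def paste (m : ℕ) (w x : Seq) : Seq := fun k => if k ≤ m then w k else x k

theorem paste_agree (m : ℕ) (w x : Seq) : Agree m (paste m w x) w := fun _ hk => if_pos hk

theorem paste_of_lt {m k : ℕ} (hk : m < k) (w x : Seq) : paste m w x k = x k :=
  if_neg hk.not_ge

theorem paste_paste {m : ℕ} {v w x : Seq} (h : Agree m x v) : paste m v (paste m w x) = x := by
  funext k
  unfold paste
  split_ifs with hk
  exacts [(h k hk).symm, rfl]

theorem update_agree {m n : ℕ} (hmn : m ≤ n) (x : Seq) (a : Fin (size (n + 1))) :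
    Agree m (Function.update x (n + 1) a) x := fun _ hk =>
  Function.update_of_ne (by omega) _ _

open Classical in
/-- The map which increases the coordinate of index `n + 1` by one on the cylinder of `v` and
decreases it by one on the cylinder of `w`; where this is impossible, it interchanges the two
initial segments instead. -/
noncomputable def shift (m n : ℕ) (v w x : Seq) : Seq :=
  if Agree m x v then
    -- Addition in `Fin` is cyclic, so this test excludes the last value.
    if x (n + 1) + 1 ≠ 0 then Function.update x (n + 1) (x (n + 1) + 1) else paste m w x
  else if Agree m x w then
    if x (n + 1) ≠ 0 then Function.update x (n + 1) (x (n + 1) - 1) else paste m v x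
  else x

/-- The upward moves leave the value 0 free in the cylinder of v, and the downward moves leave the
last value free in that of w. The interchanges fill exactly these two gaps, so swapping the roles of
v and w undoes the map. -/
theorem shift_shift {m n : ℕ} (hmn : m ≤ n) {v w : Seq} (hvw : ¬ Agree m v w) (x : Seq) :
    shift m n w v (shift m n v w x) = x := by
  have hlt : m < n + 1 := Nat.lt_succ_of_le hmn
  by_cases h1 : Agree m x v
  · by_cases h2 : x (n + 1) + 1 ≠ 0
    · have e : shift m n v w x = Function.update x (n + 1) (x (n + 1) + 1) := by
        rw [shift, if_pos h1, if_pos h2]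
      have a := (update_agree hmn x (x (n + 1) + 1)).trans h1
      rw [e, shift, if_neg fun h => hvw (a.symm.trans h), if_pos a]
      simp [h2]
    · have e : shift m n v w x = paste m w x := by
        rw [shift, if_pos h1, if_neg h2]
      rw [e, shift, if_pos (paste_agree m w x), paste_of_lt hlt, if_neg h2, paste_paste h1]
  · by_cases h3 : Agree m x w
    · by_cases h2 : x (n + 1) ≠ 0
      · have e : shift m n v w x = Function.update x (n + 1) (x (n + 1) - 1) := by
          rw [shift, if_neg h1, if_pos h3, if_pos h2]
        have a := (update_agree hmn x (x (n + 1) - 1)).trans h3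
        rw [e, shift, if_pos a]
        simp [h2]
      · have e : shift m n v w x = paste m v x := by
          rw [shift, if_neg h1, if_pos h3, if_neg h2]
        have a := paste_agree m v x
        rw [e, shift, if_neg fun h => hvw (a.symm.trans h), if_pos a, paste_of_lt hlt, if_neg h2,
          paste_paste h3]
    · have e : shift m n v w x = x := by
        rw [shift, if_neg h1, if_neg h3]
      rw [e, shift, if_neg h3, if_neg h1]

theorem update_agree_update {M : ℕ} {x y : Seq} (h : Agree M x y) (j : ℕ) (a : Fin (size j)) :
    Agree M (Function.update x j a) (Function.update y j a) := by
  intro k hk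
  by_cases hkj : k = j
  · subst hkj; simp
  · rw [Function.update_of_ne hkj, Function.update_of_ne hkj, h k hk]

theorem paste_agree_paste {M : ℕ} {x y : Seq} (h : Agree M x y) (m : ℕ) (w : Seq) :
    Agree M (paste m w x) (paste m w y) := by
  intro k hk
  simp only [paste, h k hk]

/-- Both the choice of the branch and the change made depend only on coordinates up to n + 1. -/
theorem shift_agree {m n M : ℕ} (hmn : m ≤ n) (hM : n + 1 ≤ M) (v w : Seq) {x y : Seq}
    (h : Agree M x y) : Agree M (shift m n v w x) (shift m n v w y) := by
  have hm : Agree m x y := h.mono (by omega)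
  have h2 : y (n + 1) = x (n + 1) := (h _ hM).symm
  have h1 : ∀ u, Agree m y u = Agree m x u := fun u =>
    propext ⟨hm.trans, hm.symm.trans⟩
  unfold shift
  rw [h2, h1 v, h1 w]
  split_ifs
  exacts [update_agree_update h _ _, paste_agree_paste h _ _, update_agree_update h _ _,
    paste_agree_paste h _ _, h]

theorem shift_zero {m n : ℕ} {v w : Seq} (h : v 0 = w 0) (x : Seq) : shift m n v w x 0 = x 0 := by
  unfold shift
  split_ifs with h1 _ h2
  · exact Function.update_of_ne (by omega) _ _
  · exact (paste_agree m w x 0 m.zero_le).trans (h.symm.trans (h1 0 m.zero_le).symm)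
  · exact Function.update_of_ne (by omega) _ _
  · exact (paste_agree m v x 0 m.zero_le).trans (h.trans (h2 0 m.zero_le).symm)
  · rfl

theorem shift_of_gt {m n k : ℕ} (hmn : m ≤ n) (hk : n + 1 < k) (v w x : Seq) :
    shift m n v w x k = x k := by
  unfold shift
  split_ifs
  · exact Function.update_of_ne (by omega) _ _
  · exact paste_of_lt (by omega) _ _
  · exact Function.update_of_ne (by omega) _ _
  · exact paste_of_lt (by omega) _ _
  · rfl

theorem shift_eq_self {m n : ℕ} {v w x : Seq} (hv : ¬ Agree m x v) (hw : ¬ Agree m x w) :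
    shift m n v w x = x := by
  rw [shift, if_neg hv, if_neg hw]

/-- The points whose coordinate of index `k` is extremal. -/
def extremal (k : ℕ) : Set Seq := {x | x k = 0} ∪ {x | x k = -1}

theorem measurableSet_extremal (k : ℕ) : MeasurableSet (extremal k) :=
  (measurableSet_coord k _).union (measurableSet_coord k _)

theorem mu_extremal (k : ℕ) : mu (extremal k) ≤ 2 * (size k : ℝ≥0∞)⁻¹ :=
  (measure_union_le _ _).trans (by rw [mu_coord, mu_coord, two_mul])

/-- Initial segments are interchanged only at extremal values of coordinate n + 1; otherwise that
coordinate alone can change. -/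
theorem shift_agree_self {m n : ℕ} {v w x : Seq} (hx : x ∉ extremal (n + 1)) :
    Agree n (shift m n v w x) x := by
  simp only [extremal, Set.mem_union, Set.mem_ofPred_eq, not_or] at hx
  unfold shift
  split_ifs with _ h _ h
  · exact update_agree le_rfl _ _
  · exact absurd (eq_neg_of_add_eq_zero_left (not_not.mp h)) hx.2
  · exact update_agree le_rfl _ _
  · exact absurd (not_not.mp h) hx.1
  · exact Agree.refl _ _

theorem val_add_one {N : ℕ} [NeZero N] {a : Fin N} (h : a + 1 ≠ 0) :
    ((a + 1 : Fin N) : ℕ) = a + 1 := by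
  have e : ((a + 1 : Fin N) : ℕ) = (a + 1) % N := by simp [Fin.val_add]
  rw [e]
  refine Nat.mod_eq_of_lt (lt_of_le_of_ne a.2 fun h' => h (Fin.ext ?_))
  rw [e, h']
  simp

theorem val_sub_one {N : ℕ} [NeZero N] {a : Fin N} (h : a ≠ 0) :
    ((a - 1 : Fin N) : ℕ) + 1 = a := by
  have := val_add_one (a := a - 1) (by simpa using h)
  simpa using this.symm

theorem shift_val_sub {m n : ℕ} {v w : Seq} (hvw : ¬ Agree m v w) {x : Seq}
    (hx : x ∉ extremal (n + 1)) :
    ((shift m n v w x (n + 1) : ℕ) : ℝ) - ((x (n + 1) : ℕ) : ℝ) =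
      (cyl m v).indicator 1 x - (cyl m w).indicator 1 x := by
  simp only [extremal, Set.mem_union, Set.mem_ofPred_eq, not_or] at hx
  have h1 : x (n + 1) + 1 ≠ 0 := fun h => hx.2 (eq_neg_of_add_eq_zero_left h)
  by_cases hv : Agree m x v
  · have hw : ¬ Agree m x w := fun hw => hvw (hv.symm.trans hw)
    rw [shift, if_pos hv, if_pos h1, Function.update_self, val_add_one h1,
      Set.indicator_of_mem hv, Set.indicator_of_notMem hw]
    simp
  · by_cases hw : Agree m x w
    · rw [shift, if_neg hv, if_pos hw, if_pos hx.1, Function.update_self,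
        Set.indicator_of_notMem hv, Set.indicator_of_mem hw, ← val_sub_one hx.1]
      simp
    · rw [shift_eq_self hv hw, Set.indicator_of_notMem hv, Set.indicator_of_notMem hw]
      simp

theorem abs_shift_val_sub_le {m n : ℕ} (hmn : m ≤ n) (v w x : Seq) :
    |((shift m n v w x (n + 1) : ℕ) : ℝ) - ((x (n + 1) : ℕ) : ℝ)| ≤ 1 := by
  unfold shift
  split_ifs with _ h _ h
  · rw [Function.update_self, val_add_one h]; simp
  · rw [paste_of_lt (by omega)]; simp
  · rw [Function.update_self, ← val_sub_one h]; simp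
  · rw [paste_of_lt (by omega)]; simp
  · simp

/-- The properties of the permutations by which the involutions are conjugated. -/
structure IsSmall (n : ℕ) (r : Equiv.Perm Seq) : Prop where
  isLocal : IsLocal (n + 1) r
  zero : ∀ x, r x 0 = x 0
  of_gt : ∀ k, n + 1 < k → ∀ x, r x k = x k
  agree_self : ∀ x, x ∉ extremal (n + 1) → Agree n (r x) x

theorem isSmall_one (n : ℕ) : IsSmall n 1 :=
  ⟨fun _ _ _ _ => Iff.rfl, fun _ => rfl, fun _ _ _ => rfl, fun _ _ => Agree.refl _ _⟩

/-- `shift` as a permutation. -/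
noncomputable def shiftPerm {m n : ℕ} (hmn : m ≤ n) {v w : Seq} (hvw : ¬ Agree m v w) :
    Equiv.Perm Seq where
  toFun := shift m n v w
  invFun := shift m n w v
  left_inv := shift_shift hmn hvw
  right_inv := shift_shift hmn fun h => hvw h.symm

theorem isSmall_shiftPerm {m n : ℕ} (hmn : m ≤ n) {v w : Seq} (hvw : ¬ Agree m v w)
    (h0 : v 0 = w 0) : IsSmall n (shiftPerm hmn hvw) where
  isLocal M hM x y := by
    refine ⟨shift_agree hmn hM v w, fun h => ?_⟩
    have := shift_agree hmn hM w v h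
    rwa [show shift m n w v (shiftPerm hmn hvw x) = x from shift_shift hmn hvw x,
      show shift m n w v (shiftPerm hmn hvw y) = y from shift_shift hmn hvw y] at this
  zero := shift_zero h0
  of_gt _ hk := shift_of_gt hmn hk v w
  agree_self _ := shift_agree_self

theorem isSmall_shiftPerm_inv {m n : ℕ} (hmn : m ≤ n) {v w : Seq} (hvw : ¬ Agree m v w)
    (h0 : v 0 = w 0) : IsSmall n (shiftPerm hmn hvw)⁻¹ :=
  isSmall_shiftPerm hmn (fun h => hvw h.symm) h0.symm

/-! ### Towers of conjugates and their limits -/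

/-- The involution `flip`, conjugated successively by the permutations `r 0, …, r (n - 1)`. -/
def tower (r : ℕ → Equiv.Perm Seq) : ℕ → Equiv.Perm Seq
  | 0 => flip
  | n + 1 => (r n)⁻¹ * tower r n * r n

section

variable {r : ℕ → Equiv.Perm Seq}

theorem tower_succ_apply (n : ℕ) (x : Seq) :
    tower r (n + 1) x = (r n)⁻¹ (tower r n (r n x)) := rfl

theorem tower_tower (n : ℕ) (x : Seq) : tower r n (tower r n x) = x := by
  induction n generalizing x with
  | zero => exact flip_flip x
  | succ n ih => simp [tower_succ_apply, ih]

variable (hr : ∀ n, IsSmall n (r n)) (hr' : ∀ n, IsSmall n (r n)⁻¹)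
include hr hr'

theorem tower_zero (n : ℕ) (x : Seq) : tower r n x 0 = (x 0).rev := by
  induction n generalizing x with
  | zero => exact flip_zero x
  | succ n ih => rw [tower_succ_apply, (hr' n).zero, ih, (hr n).zero]

/-- Stage n has not yet touched coordinate n + 1, which is therefore free to serve as a potential.
-/
theorem tower_of_gt (n : ℕ) {k : ℕ} (hk : n < k) (x : Seq) : tower r n x k = x k := by
  induction n generalizing x with
  | zero => exact flip_of_pos x hk
  | succ n ih =>
    rw [tower_succ_apply, (hr' n).of_gt k hk, ih (by omega), (hr n).of_gt k hk]

theorem isLocal_tower (n : ℕ) : IsLocal n (tower r n) := by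
  induction n with
  | zero => exact isLocal_flip
  | succ n ih => exact ((hr' n).isLocal.mul (ih.mono n.le_succ)).mul (hr n).isLocal

/-- Away from extremal values neither of the two conjugating factors changes the coordinates up to
n, and `tower r n` respects agreement up to n. -/
theorem tower_succ_agree {n : ℕ} {x : Seq} (h : x ∉ extremal (n + 1))
    (h' : tower r n (r n x) ∉ extremal (n + 1)) :
    Agree n (tower r (n + 1) x) (tower r n x) :=
  ((hr' n).agree_self _ h').trans
    ((isLocal_tower hr hr' n n le_rfl _ _).mp ((hr n).agree_self x h))

/-- The points where the stages `n` and `n + 1` may differ up to `n`. -/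
def bad (r : ℕ → Equiv.Perm Seq) (n : ℕ) : Set Seq :=
  extremal (n + 1) ∪ (tower r n * r n) ⁻¹' extremal (n + 1)

theorem measurableSet_bad (n : ℕ) : MeasurableSet (bad r n) :=
  (measurableSet_extremal _).union
    ((((isLocal_tower hr hr' n).mono n.le_succ).mul (hr n).isLocal).measurable
      (measurableSet_extremal _))

theorem mu_bad (n : ℕ) : mu (bad r n) ≤ 4 * (size (n + 1) : ℝ≥0∞)⁻¹ := by
  refine (measure_union_le _ _).trans ?_
  rw [(((isLocal_tower hr hr' n).mono n.le_succ).mul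
    (hr n).isLocal).measurePreserving.measure_preimage
      (measurableSet_extremal _).nullMeasurableSet]
  calc _ ≤ 2 * (size (n + 1) : ℝ≥0∞)⁻¹ + 2 * (size (n + 1) : ℝ≥0∞)⁻¹ :=
        add_le_add (mu_extremal _) (mu_extremal _)
    _ = _ := by rw [← add_mul]; norm_num

/-- The points where the stages from `n` on may differ up to `n`. -/
def tail (r : ℕ → Equiv.Perm Seq) (n : ℕ) : Set Seq := ⋃ k, bad r (n + k)

theorem measurableSet_tail (n : ℕ) : MeasurableSet (tail r n) :=
  MeasurableSet.iUnion fun _ => measurableSet_bad hr hr' _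

omit hr hr' in
theorem two_pow_mul_size_le (n k : ℕ) : 2 ^ k * size n ≤ size (n + k) := by
  induction k with
  | zero => simp
  | succ k ih =>
    calc 2 ^ (k + 1) * size n = 2 * (2 ^ k * size n) := by ring
      _ ≤ 2 * size (n + k) := by gcongr
      _ ≤ _ := two_mul_size_le _

theorem mu_tail (n : ℕ) : mu (tail r n) ≤ 8 * (size (n + 1) : ℝ≥0∞)⁻¹ := by
  calc mu (tail r n) ≤ ∑' k, mu (bad r (n + k)) := measure_iUnion_le _
    -- Sizes at least double at each step, which gives a geometric series with sum 2.
    _ ≤ ∑' k : ℕ, (4 * (size (n + 1) : ℝ≥0∞)⁻¹) * (2⁻¹ : ℝ≥0∞) ^ k := by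
        refine ENNReal.tsum_le_tsum fun k => (mu_bad hr hr' _).trans ?_
        rw [mul_assoc]
        gcongr
        rw [← ENNReal.inv_pow, ← ENNReal.mul_inv (by simp) (by simp), ENNReal.inv_le_inv]
        have := two_pow_mul_size_le (n + 1) k
        rw [mul_comm, show n + 1 + k = n + k + 1 by ring] at this
        exact_mod_cast this
    _ = 8 * (size (n + 1) : ℝ≥0∞)⁻¹ := by
        rw [ENNReal.tsum_mul_left, ENNReal.tsum_geometric_two, mul_right_comm]
        norm_num

theorem tower_agree_of_notMem_tail {n : ℕ} {x : Seq} (hx : x ∉ tail r n) {k : ℕ} (hk : n ≤ k) :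
    Agree n (tower r k x) (tower r n x) := by
  induction k, hk using Nat.le_induction with
  | base => exact Agree.refl _ _
  | succ k hk ih =>
    refine Agree.trans (Agree.mono hk (tower_succ_agree hr hr' ?_ ?_)) ih
    · refine fun h => hx (Set.mem_iUnion.mpr ⟨k - n, Or.inl ?_⟩)
      rwa [Nat.add_sub_cancel' hk]
    · refine fun h => hx (Set.mem_iUnion.mpr ⟨k - n, Or.inr ?_⟩)
      rwa [Nat.add_sub_cancel' hk]

end

open Filter Topology

theorem tendsto_mul_size_inv (c : ℝ≥0∞) (hc : c ≠ ∞) :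
    Tendsto (fun n => c * (size (n + 1) : ℝ≥0∞)⁻¹) atTop (𝓝 0) := by
  have h : Tendsto (fun n => (size (n + 1) : ℝ≥0∞)⁻¹) atTop (𝓝 0) := by
    refine ENNReal.tendsto_inv_nat_nhds_zero.comp (tendsto_atTop_mono (fun n => ?_) tendsto_id)
    exact (Nat.lt_two_pow_self.le.trans (Nat.pow_le_pow_right (by norm_num) n.le_succ)).trans
      (two_pow_le_size (n + 1))
  simpa using ENNReal.Tendsto.const_mul h (Or.inr hc)

section

variable {r : ℕ → Equiv.Perm Seq}

theorem tail_antitone : Antitone (tail r) := by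
  intro n m hnm x hx
  obtain ⟨k, hk⟩ := Set.mem_iUnion.mp hx
  refine Set.mem_iUnion.mpr ⟨m - n + k, ?_⟩
  rwa [← add_assoc, Nat.add_sub_cancel' hnm]

variable (hr : ∀ n, IsSmall n (r n)) (hr' : ∀ n, IsSmall n (r n)⁻¹)
include hr hr'

theorem ae_exists_notMem_tail : ∀ᵐ x ∂mu, ∃ n, x ∉ tail r n := by
  have h : mu (⋂ n, tail r n) = 0 := by
    refine le_antisymm (ge_of_tendsto' (tendsto_mul_size_inv 8 (by simp)) fun n => ?_) zero_le
    exact (measure_mono (Set.iInter_subset _ n)).trans (mu_tail hr hr' n)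
  filter_upwards [measure_eq_zero_iff_ae_notMem.mp h] with x hx
  simpa using hx

/-- Outside `tail r n` the coordinates up to n are frozen from stage n on, and almost every point
eventually leaves these decreasing sets. So almost everywhere each coordinate is eventually
constant. -/
theorem exists_limit : ∃ S : Seq → Seq, Measurable S ∧
    ∀ᵐ x ∂mu, ∀ n, x ∉ tail r n → Agree n (S x) (tower r n x) := by
  obtain ⟨S, hS, hlim⟩ := measurable_limit_of_tendsto_metrizable_ae (μ := mu) (L := atTop)
    (f := fun n x => tower r n x)
    (fun n => (isLocal_tower hr hr' n).measurable.aemeasurable) (by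
      filter_upwards [ae_exists_notMem_tail hr hr'] with x ⟨n, hn⟩
      refine ⟨fun k => tower r (max n k) x k, tendsto_pi_nhds.mpr fun k => ?_⟩
      refine tendsto_const_nhds.congr' ?_
      filter_upwards [eventually_ge_atTop (max n k)] with j hj
      exact ((tower_agree_of_notMem_tail hr hr'
        (fun h => hn (tail_antitone (le_max_left n k) h)) hj) k (le_max_right n k)).symm)
  refine ⟨S, hS, hlim.mono fun x hx n hn k hk => ?_⟩
  have h := tendsto_pi_nhds.mp hx k
  rw [nhds_discrete, tendsto_pure] at h
  obtain ⟨j, hj, hnj⟩ := (h.and (eventually_ge_atTop n)).exists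
  rw [← hj]
  exact tower_agree_of_notMem_tail hr hr' hn hnj k hk

/-- Up to a null set, the preimages of a cylinder under the limit and under a late stage k differ
only inside `tail r k`, whose measure tends to 0. -/
theorem measurePreserving_limit {S : Seq → Seq} (hS : Measurable S)
    (h : ∀ᵐ x ∂mu, ∀ n, x ∉ tail r n → Agree n (S x) (tower r n x)) :
    MeasurePreserving S mu mu := by
  refine measurePreserving_of_cyl hS 0 fun n _ y => ?_
  have hm : ∀ k, n ≤ k → mu (tower r k ⁻¹' cyl n y) = mass n := fun k hk => by
    rw [(isLocal_tower hr hr' k).measurePreserving.measure_preimage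
      (measurableSet_cyl n y).nullMeasurableSet, mu_cyl]
  have ha : ∀ k, n ≤ k → ∀ᵐ x ∂mu, x ∉ tail r k → (S x ∈ cyl n y ↔ tower r k x ∈ cyl n y) := by
    intro k hk
    filter_upwards [h] with x hx hxk
    have := (hx k hxk).mono hk
    exact ⟨this.symm.trans, this.trans⟩
  have hb : ∀ (a b : ℝ≥0∞), (∀ k, n ≤ k → a ≤ b + mu (tail r k)) → a ≤ b := by
    intro a b hab
    have ht : Tendsto (fun k => b + 8 * (size (k + 1) : ℝ≥0∞)⁻¹) atTop (𝓝 (b + 0)) :=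
      tendsto_const_nhds.add (tendsto_mul_size_inv 8 (by simp))
    rw [add_zero] at ht
    refine ge_of_tendsto ht ?_
    filter_upwards [eventually_ge_atTop n] with k hk
    exact (hab k hk).trans (by gcongr; exact mu_tail hr hr' k)
  refine le_antisymm (hb _ _ fun k hk => ?_) (hb _ _ fun k hk => ?_)
  · rw [← hm k hk]
    refine (measure_mono_ae ?_).trans (measure_union_le _ _)
    filter_upwards [ha k hk] with x hx hxS
    by_cases hxk : x ∈ tail r k
    exacts [Or.inr hxk, Or.inl ((hx hxk).mp hxS)]
  · rw [← hm k hk]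
    refine (measure_mono_ae ?_).trans (measure_union_le _ _)
    filter_upwards [ha k hk] with x hx hxS
    by_cases hxk : x ∈ tail r k
    exacts [Or.inr hxk, Or.inl ((hx hxk).mpr hxS)]

theorem limit_limit {S : Seq → Seq} (hS : Measurable S)
    (h : ∀ᵐ x ∂mu, ∀ n, x ∉ tail r n → Agree n (S x) (tower r n x)) :
    ∀ᵐ x ∂mu, S (S x) = x := by
  have hp := (measurePreserving_limit hr hr' hS h).quasiMeasurePreserving
  filter_upwards [h, hp.ae h, ae_exists_notMem_tail hr hr',
    hp.ae (ae_exists_notMem_tail hr hr')] with x hx hSx ⟨a, ha⟩ ⟨b, hb⟩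
  -- Choose an order n beyond k at which both x and `S x` have left the tail. Then `S (S x)` agrees
  -- up to n with the n-th stage applied twice, which is the identity.
  funext k
  let n := max k (max a b)
  have h1 := hx n fun hn => ha (tail_antitone ((le_max_left a b).trans (le_max_right _ _)) hn)
  have h2 := hSx n fun hn => hb (tail_antitone ((le_max_right a b).trans (le_max_right _ _)) hn)
  have h3 := h2.trans ((isLocal_tower hr hr' n n le_rfl _ _).mp h1)
  rw [tower_tower] at h3
  exact h3 k (le_max_left _ _)

theorem exists_involution : ∃ S : Equiv.Perm Seq, (∀ x, S (S x) = x) ∧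
    MeasurePreserving S mu mu ∧ (∀ᵐ x ∂mu, S x 0 = (x 0).rev) ∧
    ∀ᵐ x ∂mu, ∀ n, x ∉ tail r n → Agree n (S x) (tower r n x) := by
  classical
  obtain ⟨S, hS, h⟩ := exists_limit hr hr'
  have hSS := limit_limit hr hr' hS h
  -- A group action needs an involution everywhere. The set where S is involutive is mapped to
  -- itself by S, so S may be replaced by the identity off this set.
  let T : Seq → Seq := fun x => if S (S x) = x then S x else x
  have hT : Function.Involutive T := by
    intro x
    by_cases hx : S (S x) = x
    · have e : T x = S x := if_pos hx
      rw [e]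
      exact (if_pos (congrArg S hx)).trans hx
    · have e : T x = x := if_neg hx
      rw [e, e]
  have hTm : Measurable T :=
    Measurable.ite (measurableSet_eq_fun (hS.comp hS) measurable_id) hS measurable_id
  have hTS : ∀ᵐ x ∂mu, T x = S x := hSS.mono fun x hx => if_pos hx
  have hTa : ∀ᵐ x ∂mu, ∀ n, x ∉ tail r n → Agree n (T x) (tower r n x) := by
    filter_upwards [h, hTS] with x hx hxT
    rwa [hxT]
  refine ⟨hT.toPerm, hT, measurePreserving_limit hr hr' hTm hTa, ?_, hTa⟩
  filter_upwards [hTa, ae_exists_notMem_tail hr hr'] with x hx ⟨n, hn⟩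
  exact (hx n hn 0 n.zero_le).trans (tower_zero hr hr' n x)

end

/-! ### Dipoles as approximate gradients -/

/-- One side of the bipartition. -/
def side : Set Seq := {x | x 0 = 0}

theorem measurableSet_side : MeasurableSet side := measurableSet_coord 0 0

theorem rev_ne_zero_iff (a : Fin (size 0)) : a.rev ≠ 0 ↔ a = 0 := by
  revert a; decide

/-- The function prescribed along the edges with a given color. -/
noncomputable def dipole (m : ℕ) (v w x : Seq) : ℝ :=
  (cyl m v).indicator 1 x - (cyl m w).indicator 1 x

theorem abs_dipole_le (m : ℕ) (v w x : Seq) : |dipole m v w x| ≤ 1 := by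
  unfold dipole Set.indicator
  split_ifs <;> simp

/-- The data of a shift: a color, and two initial segments of equal length. -/
abbrev Task (d : ℕ) : Type := Fin d × Σ m, Word m × Word m

theorem exists_schedule {d : ℕ} (hd : 0 < d) :
    ∃ f : ℕ → Task d, ∀ t N, ∃ n, N ≤ n ∧ f n = t := by
  have : Nonempty (Task d × ℕ) :=
    ⟨((⟨0, hd⟩, ⟨0, fun _ => 0, fun _ => 0⟩), 0)⟩
  -- The second component only serves to make every task occur infinitely often.
  obtain ⟨g, hg⟩ := exists_surjective_nat (Task d × ℕ)
  refine ⟨fun n => (g n).1, fun t N => ?_⟩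
  have hinf : {n | (g n).1 = t}.Infinite := by
    refine Set.infinite_of_injective_forall_mem (f := fun k : ℕ => (hg (t, k)).choose) ?_ ?_
    · intro k k' hk
      have h1 := (hg (t, k)).choose_spec
      have h2 := (hg (t, k')).choose_spec
      have h3 : (hg (t, k)).choose = (hg (t, k')).choose := hk
      rw [h3] at h1
      exact congrArg Prod.snd (h1.symm.trans h2)
    · intro k
      exact congrArg Prod.fst (hg (t, k)).choose_spec
  obtain ⟨n, hn, hN⟩ := hinf.exists_gt N
  exact ⟨n, hN.le, hn⟩

open Classical in
/-- The permutation by which the involution with color `i` is conjugated at the stage `n`, if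
the task of this stage is `t`. -/
noncomputable def taskPerm {d : ℕ} (t : Task d) (i : Fin d) (n : ℕ) : Equiv.Perm Seq :=
  if h : t.2.1 ≤ n ∧ ¬ Agree t.2.1 t.2.2.1.extend t.2.2.2.extend ∧
      t.2.2.1.extend 0 = t.2.2.2.extend 0 ∧ t.1 = i then
    shiftPerm h.1 h.2.1
  else 1

theorem isSmall_taskPerm {d : ℕ} (t : Task d) (i : Fin d) (n : ℕ) :
    IsSmall n (taskPerm t i n) := by
  unfold taskPerm
  split_ifs with h
  exacts [isSmall_shiftPerm _ _ h.2.2.1, isSmall_one n]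

theorem isSmall_taskPerm_inv {d : ℕ} (t : Task d) (i : Fin d) (n : ℕ) :
    IsSmall n (taskPerm t i n)⁻¹ := by
  unfold taskPerm
  split_ifs with h
  · exact isSmall_shiftPerm_inv _ _ h.2.2.1
  · rw [inv_one]; exact isSmall_one n

/-- A real-valued coordinate. -/
def height (n : ℕ) (x : Seq) : ℝ := ((x n : ℕ) : ℝ)

theorem measurable_height (n : ℕ) : Measurable (height n) :=
  (measurable_of_countable fun a : Fin (size n) => ((a : ℕ) : ℝ)).comp (measurable_pi_apply n)

theorem height_nonneg (n : ℕ) (x : Seq) : 0 ≤ height n x := Nat.cast_nonneg _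

theorem height_le (n : ℕ) (x : Seq) : height n x ≤ size n - 1 := by
  have : ((x n : ℕ) : ℝ) + 1 ≤ size n := by exact_mod_cast (x n).2
  unfold height
  linarith

/-- Both cylinders lie in `side`. Starting there, the first factor applies the shift, the middle one
crosses to the other side without changing coordinate n + 1, and there the last factor does nothing.
So exactly one shift is felt. -/
theorem height_tower_of_eq {r : ℕ → Equiv.Perm Seq} (hr : ∀ n, IsSmall n (r n))
    (hr' : ∀ n, IsSmall n (r n)⁻¹) {m n : ℕ} {v w : Seq} (hmn : m ≤ n) (hvw : ¬ Agree m v w)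
    (hv : v 0 = 0) (hw : w 0 = 0) (h : r n = shiftPerm hmn hvw) {x : Seq} (hx : x ∈ side) :
    height (n + 1) (tower r (n + 1) x) = height (n + 1) (shift m n v w x) := by
  have h0 : tower r n (r n x) 0 ≠ 0 := by
    rw [tower_zero hr hr', (hr n).zero, rev_ne_zero_iff]
    exact hx
  have h1 : (r n)⁻¹ (tower r n (r n x)) = tower r n (r n x) := by
    rw [h]
    refine shift_eq_self (fun ha => ?_) (fun ha => ?_)
    · exact absurd ((ha 0 m.zero_le).trans hw) (h ▸ h0)
    · exact absurd ((ha 0 m.zero_le).trans hv) (h ▸ h0)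
  unfold height
  rw [tower_succ_apply, h1, tower_of_gt hr hr' n n.lt_succ_self, h]
  rfl

/-- Off both exceptional sets the error vanishes: color i realizes the dipole, and every other color
is conjugated by the identity at stage n. At extremal values the increment and the dipole are each
at most 1 in absolute value, whence 4. On the tail only the range of the potential is known. -/
theorem sq_le_of_tower {d : ℕ} {f : ℕ → Task d} {i : Fin d} {m n : ℕ} {p q : Word m}
    (hn : m ≤ n) (hf : f n = (i, ⟨m, p, q⟩)) (hp : p.extend 0 = 0) (hq : q.extend 0 = 0)
    (hpq : ¬ Agree m p.extend q.extend) (j : Fin d) {x y : Seq} (hx : x ∈ side)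
    (hy : x ∉ tail (fun k => taskPerm (f k) j k) (n + 1) →
      Agree (n + 1) y (tower (fun k => taskPerm (f k) j k) (n + 1) x)) :
    (height (n + 1) y - height (n + 1) x - if j = i then dipole m p.extend q.extend x else 0) ^ 2 ≤
      (extremal (n + 1)).indicator (fun _ => 4) x +
        (tail (fun k => taskPerm (f k) j k) (n + 1)).indicator
          (fun _ => (size (n + 1) : ℝ) ^ 2) x := by
  have hnn : 0 ≤ (extremal (n + 1)).indicator (fun _ => (4 : ℝ)) x :=
    Set.indicator_nonneg (fun _ _ => by norm_num) _
  have hnn' : 0 ≤ (tail (fun k => taskPerm (f k) j k) (n + 1)).indicator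
      (fun _ => (size (n + 1) : ℝ) ^ 2) x :=
    Set.indicator_nonneg (fun _ _ => by positivity) _
  have hr := fun k => isSmall_taskPerm (f k) j k
  have hr' := fun k => isSmall_taskPerm_inv (f k) j k
  have hd := abs_le.mp (abs_dipole_le m p.extend q.extend x)
  by_cases hxt : x ∈ tail (fun k => taskPerm (f k) j k) (n + 1)
  · rw [Set.indicator_of_mem hxt]
    refine le_add_of_nonneg_of_le hnn (sq_le_sq' ?_ ?_)
    all_goals
      have := height_nonneg (n + 1) x
      have := height_nonneg (n + 1) y
      have := height_le (n + 1) x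
      have := height_le (n + 1) y
      split_ifs <;> linarith
  · have hyx : height (n + 1) y =
        height (n + 1) (tower (fun k => taskPerm (f k) j k) (n + 1) x) := by
      unfold height
      rw [hy hxt _ le_rfl]
    rw [hyx]
    by_cases hj : j = i
    · subst hj
      have ht : taskPerm (f n) j n = shiftPerm hn hpq := by
        rw [hf]
        exact dif_pos ⟨hn, hpq, hp.trans hq.symm, rfl⟩
      rw [height_tower_of_eq hr hr' hn hpq hp hq ht hx, if_pos rfl]
      refine le_add_of_le_of_nonneg ?_ hnn'
      by_cases hxe : x ∈ extremal (n + 1)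
      · rw [Set.indicator_of_mem hxe]
        have h1 := abs_le.mp (abs_shift_val_sub_le hn p.extend q.extend x)
        unfold height
        nlinarith
      · have : height (n + 1) (shift m n p.extend q.extend x) - height (n + 1) x =
            dipole m p.extend q.extend x := shift_val_sub hpq hxe
        rw [this, sub_self]
        simpa using hnn
    · have ht : taskPerm (f n) j n = 1 := by
        rw [hf]
        exact dif_neg fun h => hj h.2.2.2.symm
      have : height (n + 1) (tower (fun k => taskPerm (f k) j k) (n + 1) x) =
          height (n + 1) x := by
        unfold height
        rw [tower_succ_apply]
        simp only [ht, inv_one, Equiv.Perm.one_apply]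
        rw [tower_of_gt hr hr' n n.lt_succ_self]
      rw [this, if_neg hj]
      simpa using add_nonneg hnn hnn'

theorem exists_involutions {d : ℕ} (hd : 0 < d) : ∃ S : Fin d → Equiv.Perm Seq,
    (∀ i x, S i (S i x) = x) ∧ (∀ i, MeasurePreserving (S i) mu mu) ∧
    (∀ i, ∀ᵐ x ∂mu, S i x 0 = (x 0).rev) ∧
    ∀ (i : Fin d) (m : ℕ) (v w : Seq), v ∈ side → w ∈ side → ¬ Agree m v w →
      ∀ ε : ℝ, 0 < ε → ∃ h : Seq → ℝ, Measurable h ∧ (∃ C, ∀ x, |h x| ≤ C) ∧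
        ∀ j, ∫ x in side, (h (S j x) - h x - if j = i then dipole m v w x else 0) ^ 2 ∂mu ≤ ε := by
  obtain ⟨f, hf⟩ := exists_schedule hd
  have hr := fun j k => isSmall_taskPerm (f k) j k
  have hr' := fun j k => isSmall_taskPerm_inv (f k) j k
  choose S hSS hSp hS0 hSt using fun j => exists_involution (hr j) (hr' j)
  refine ⟨S, hSS, hSp, hS0, fun i m v w hv hw hvw ε hε => ?_⟩
  obtain ⟨p, hp⟩ := exists_word m v
  obtain ⟨q, hq⟩ := exists_word m w
  have hp0 : p.extend 0 = 0 := (hp 0 m.zero_le).trans hv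
  have hq0 : q.extend 0 = 0 := (hq 0 m.zero_le).trans hw
  have hpq : ¬ Agree m p.extend q.extend := fun h => hvw (hp.symm.trans (h.trans hq))
  have hdip : ∀ x, dipole m v w x = dipole m p.extend q.extend x := fun x => by
    rw [dipole, dipole, cyl_eq_of_agree hp, cyl_eq_of_agree hq]
  -- The final error is 16 / `size (n + 1)`, where 16 = 2 · 4 + 8 combines the extremal set and the
  -- tail.
  obtain ⟨N, hN⟩ := exists_nat_gt (16 / ε)
  obtain ⟨n, hn, hfn⟩ := hf (i, ⟨m, p, q⟩) (max m N)
  refine ⟨height (n + 1), measurable_height _, ⟨size (n + 1), fun x => ?_⟩, fun j => ?_⟩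
  · rw [abs_of_nonneg (height_nonneg _ _)]
    linarith [height_le (n + 1) x]
  -- The index is n + 1 because coordinate n + 1 itself must be frozen. The tail then has measure
  -- governed by `size (n + 2)`.
  set T := tail (fun k => taskPerm (f k) j k) (n + 1) with hT
  have hTm : MeasurableSet T := measurableSet_tail (hr j) (hr' j) _
  have hi1 : Integrable ((extremal (n + 1)).indicator (fun _ => (4 : ℝ))) (mu.restrict side) :=
    (integrable_const _).indicator (measurableSet_extremal _)
  have hi2 : Integrable (T.indicator (fun _ => (size (n + 1) : ℝ) ^ 2)) (mu.restrict side) :=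
    (integrable_const _).indicator hTm
  have hle : ∫ x in side, (height (n + 1) (S j x) - height (n + 1) x -
      if j = i then dipole m v w x else 0) ^ 2 ∂mu ≤
      ∫ x in side, ((extremal (n + 1)).indicator (fun _ => (4 : ℝ)) x +
        T.indicator (fun _ => (size (n + 1) : ℝ) ^ 2) x) ∂mu := by
    refine integral_mono_of_nonneg (Eventually.of_forall fun x => sq_nonneg _) (hi1.add hi2) ?_
    filter_upwards [ae_restrict_of_ae (hSt j), ae_restrict_mem measurableSet_side] with x hx hxs
    simp only [hdip]
    exact sq_le_of_tower ((le_max_left _ _).trans hn) hfn hp0 hq0 hpq j hxs (hx (n + 1))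
  refine hle.trans ?_
  have hs : (0 : ℝ) < size (n + 1) := by exact_mod_cast size_pos (n + 1)
  rw [integral_add hi1 hi2, integral_indicator (measurableSet_extremal _), integral_indicator hTm]
  simp only [integral_const, smul_eq_mul, Measure.real, Measure.restrict_apply MeasurableSet.univ,
    Set.univ_inter, Measure.restrict_apply (measurableSet_extremal _), Measure.restrict_apply hTm]
  have h1 : (mu (extremal (n + 1) ∩ side)).toReal ≤ 2 * (size (n + 1) : ℝ)⁻¹ := by
    have := ENNReal.toReal_mono (by simp [ENNReal.mul_eq_top, (size_pos _).ne'])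
      ((measure_mono Set.inter_subset_left).trans (mu_extremal (n + 1)) :
        mu (extremal (n + 1) ∩ side) ≤ _)
    simpa using this
  have h2 : (mu (T ∩ side)).toReal ≤ 8 * (size (n + 2) : ℝ)⁻¹ := by
    have := ENNReal.toReal_mono (by simp [ENNReal.mul_eq_top, (size_pos _).ne'])
      ((measure_mono Set.inter_subset_left).trans (mu_tail (hr j) (hr' j) (n + 1)) :
        mu (T ∩ side) ≤ _)
    simpa using this
  rw [size_succ (n + 1)] at h2
  push_cast at h2
  calc _ ≤ 2 * (size (n + 1) : ℝ)⁻¹ * 4 + 8 * ((size (n + 1) : ℝ) ^ 3)⁻¹ * (size (n + 1) : ℝ) ^ 2 := by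
        gcongr
    _ = 16 / size (n + 1) := by field_simp; ring
    _ ≤ ε := by
        have h3 : (N : ℝ) ≤ size (n + 1) := by
          have : N ≤ size (n + 1) :=
            ((le_max_right m N).trans hn).trans (n.le_succ.trans
              (Nat.lt_two_pow_self.le.trans (two_pow_le_size (n + 1))))
          exact_mod_cast this
        rw [div_le_iff₀ hs]
        rw [div_lt_iff₀ hε] at hN
        nlinarith

/-! ### Functions determined by their integrals over cylinders -/

theorem ae_eq_zero_of_integral_cyl {g : Seq → ℝ} (hg : Integrable g mu)
    (h : ∀ n x, ∫ y in cyl n x, g y ∂mu = 0) : g =ᵐ[mu] 0 := by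
  have huniv : ∫ y, g y ∂mu = 0 := by
    have hU : (Set.univ : Set Seq) = ⋃ a : Fin (size 0), cyl 0 (Function.update 0 0 a) := by
      refine (Set.eq_univ_of_forall fun x => Set.mem_iUnion.mpr ⟨x 0, fun k hk => ?_⟩).symm
      obtain rfl := Nat.le_zero.mp hk
      simp
    rw [← setIntegral_univ, hU, integral_iUnion_fintype (fun a => measurableSet_cyl _ _) ?_
      fun a => hg.integrableOn]
    · simp [h]
    · intro a b hab
      refine Set.disjoint_left.mpr fun x hx hx' => hab ?_
      have := (hx 0 le_rfl).symm.trans (hx' 0 le_rfl)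
      simpa using this
  refine hg.ae_eq_zero_of_forall_setIntegral_eq_zero fun s hs _ => ?_
  induction s, hs using MeasurableSpace.induction_on_inter (generateFrom_cylSets 0)
    (isPiSystem_cylSets 0) with
  | empty => simp
  | basic t ht =>
    obtain rfl | ⟨n, x, -, rfl⟩ := ht
    exacts [by simp, h n x]
  | compl t ht ih =>
    have := integral_add_compl ht hg
    rw [ih (measure_lt_top _ _), huniv, zero_add] at this
    exact this
  | iUnion f hd hm ih =>
    rw [integral_iUnion hm hd hg.integrableOn]
    simp [fun n => ih n (measure_lt_top _ _)]

theorem cyl_eq_iUnion (m : ℕ) (v : Seq) :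
    cyl m v = ⋃ a : Fin (size (m + 1)), cyl (m + 1) (Function.update v (m + 1) a) := by
  ext x
  simp only [Set.mem_iUnion, mem_cyl, agree_succ, Function.update_self]
  constructor
  · exact fun h => ⟨x (m + 1), h.trans (update_agree le_rfl v _).symm, rfl⟩
  · rintro ⟨a, h, -⟩
    exact h.trans (update_agree le_rfl v _)

/-- By induction on the order: a cylinder splits into `size (m + 1)` cylinders with equal integrals,
so the integral is divided just as the mass is. -/
theorem setIntegral_cyl {f : Seq → ℝ} (hf : Integrable f mu)
    (h : ∀ m, ∀ v ∈ side, ∀ w ∈ side, ∫ x in cyl m v, f x ∂mu = ∫ x in cyl m w, f x ∂mu)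
    (m : ℕ) (v : Seq) (hv : v ∈ side) :
    ∫ x in cyl m v, f x ∂mu =
      (∫ x in cyl 0 0, f x ∂mu) / (mass 0).toReal * (mass m).toReal := by
  have hne : ∀ m, (mass m).toReal ≠ 0 := fun m =>
    ENNReal.toReal_ne_zero.mpr ⟨mass_pos m, by rw [← mu_cyl m 0]; exact measure_ne_top _ _⟩
  induction m generalizing v with
  | zero => rw [div_mul_cancel₀ _ (hne 0)]; exact h 0 v hv 0 rfl
  | succ m ih =>
    have hu : ∀ a, Function.update v (m + 1) a ∈ side := fun a => by
      rw [side, Set.mem_ofPred_eq, Function.update_of_ne (by omega)]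
      exact hv
    have h1 := ih v hv
    rw [cyl_eq_iUnion, integral_iUnion_fintype (fun a => measurableSet_cyl _ _) ?_
      fun a => hf.integrableOn] at h1
    · rw [Finset.sum_congr rfl fun a _ => h (m + 1) _ (hu a) v hv] at h1
      rw [Finset.sum_const, Finset.card_univ, Fintype.card_fin, nsmul_eq_mul] at h1
      have hs : (size (m + 1) : ℝ) ≠ 0 := by exact_mod_cast (size_pos (m + 1)).ne'
      rw [mass_succ, ENNReal.toReal_mul, ENNReal.toReal_inv, ENNReal.toReal_natCast, ← mul_assoc,
        ← h1]
      field_simp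
    · intro a b hab
      refine Set.disjoint_left.mpr fun x hx hx' => hab ?_
      have := (hx (m + 1) le_rfl).symm.trans (hx' (m + 1) le_rfl)
      simpa using this

theorem cyl_subset_side {m : ℕ} {v : Seq} (hv : v ∈ side) : cyl m v ⊆ side :=
  fun _ hx => (hx 0 m.zero_le).trans hv

theorem exists_eq_const_of_setIntegral_cyl {f : Seq → ℝ} (hf : Integrable f mu)
    (h : ∀ m, ∀ v ∈ side, ∀ w ∈ side, ∫ x in cyl m v, f x ∂mu = ∫ x in cyl m w, f x ∂mu) :
    ∃ c, ∀ᵐ x ∂mu, x ∈ side → f x = c := by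
  set c := (∫ x in cyl 0 0, f x ∂mu) / (mass 0).toReal
  have hg : Integrable (fun x => f x - c) mu := hf.sub (integrable_const c)
  -- A cylinder lies in `side` or misses it, so all cylinder integrals of this function vanish.
  have h0 := ae_eq_zero_of_integral_cyl (g := side.indicator fun x => f x - c)
    (hg.indicator measurableSet_side) fun m v => by
      rw [setIntegral_indicator measurableSet_side]
      by_cases hv : v ∈ side
      · rw [Set.inter_eq_left.mpr (cyl_subset_side hv), integral_sub hf.integrableOn
          (integrable_const c), setIntegral_cyl hf h m v hv]
        simp [Measure.real, mu_cyl, c, mul_comm]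
      · have : cyl m v ∩ side = ∅ := by
          refine Set.eq_empty_of_forall_notMem fun x hx => hv ?_
          exact (hx.1 0 m.zero_le).symm.trans hx.2
        simp [this]
  refine ⟨c, h0.mono fun x hx hxs => ?_⟩
  rw [Set.indicator_of_mem hxs] at hx
  exact sub_eq_zero.mp hx

/-! ### Rigidity of flows -/

/-- Measure preserving involutions which interchange the sides and have almost no circulations:
every dipole is approximately a gradient. -/
structure IsSystem {d : ℕ} (S : Fin d → Equiv.Perm Seq) : Prop where
  invol : ∀ i x, S i (S i x) = x
  measurePreserving : ∀ i, MeasurePreserving (S i) mu mu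
  rev : ∀ i, ∀ᵐ x ∂mu, S i x 0 = (x 0).rev
  approx : ∀ (i : Fin d) (m : ℕ) (v w : Seq), v ∈ side → w ∈ side → ¬ Agree m v w →
    ∀ ε : ℝ, 0 < ε → ∃ h : Seq → ℝ, Measurable h ∧ (∃ C, ∀ x, |h x| ≤ C) ∧
      ∀ j, ∫ x in side, (h (S j x) - h x - if j = i then dipole m v w x else 0) ^ 2 ∂mu ≤ ε

/-- A circulation, described by its values `F i x` on the edges from `x` to `S i x`. -/
structure IsFlow {d : ℕ} (S : Fin d → Equiv.Perm Seq) (F : Fin d → Seq → ℝ) : Prop where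
  memLp : ∀ i, MemLp (F i) 2 mu
  sum_eq_zero : ∀ᵐ x ∂mu, ∑ i, F i x = 0
  antisymm : ∀ i, ∀ᵐ x ∂mu, F i (S i x) = -F i x

section

variable {d : ℕ} {S : Fin d → Equiv.Perm Seq} {F : Fin d → Seq → ℝ}

theorem IsSystem.mem_side_iff (hS : IsSystem S) (i : Fin d) :
    ∀ᵐ x ∂mu, S i x ∉ side ↔ x ∈ side := by
  filter_upwards [hS.rev i] with x hx
  simp only [side, Set.mem_ofPred_eq, hx]
  exact rev_ne_zero_iff _

/-- Summation by parts: substituting `S j x` for x and using antisymmetry moves the term with `h (S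
j x)` to the complement of `side`. Together the terms give minus the integral of h times the sum of
the `F j`, which is zero. -/
theorem IsSystem.sum_integral_gradient (hS : IsSystem S) (hF : IsFlow S F) {h : Seq → ℝ}
    (hm : Measurable h) {C : ℝ} (hC : ∀ x, |h x| ≤ C) :
    ∑ j, ∫ x in side, F j x * (h (S j x) - h x) ∂mu = 0 := by
  have hFi : ∀ j, Integrable (F j) mu := fun j => (hF.memLp j).integrable (by norm_num)
  have hFh : ∀ j, Integrable (fun x => F j x * h x) mu := fun j =>
    (hFi j).mul_bdd hm.aestronglyMeasurable (Eventually.of_forall fun x => hC x)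
  have hFhS : ∀ j, Integrable (fun x => F j x * h (S j x)) mu := fun j =>
    (hFi j).mul_bdd (hm.comp (hS.measurePreserving j).measurable).aestronglyMeasurable
      (Eventually.of_forall fun x => hC _)
  have key : ∀ j, ∫ x in side, F j x * (h (S j x) - h x) ∂mu = -∫ x, F j x * h x ∂mu := by
    intro j
    have h1 : ∫ x in side, F j x * h (S j x) ∂mu = -∫ x in sideᶜ, F j x * h x ∂mu := by
      rw [← integral_neg, ← integral_indicator measurableSet_side,
        ← integral_indicator measurableSet_side.compl]
      have hG : AEStronglyMeasurable (sideᶜ.indicator fun x => -(F j x * h x)) mu :=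
        ((hFh j).neg.indicator measurableSet_side.compl).aestronglyMeasurable
      nth_rw 2 [← (hS.measurePreserving j).map_eq]
      rw [integral_map (hS.measurePreserving j).aemeasurable
        (by rwa [(hS.measurePreserving j).map_eq])]
      refine integral_congr_ae ?_
      filter_upwards [hS.mem_side_iff j, hF.antisymm j] with x hx hx'
      by_cases hxs : x ∈ side
      · rw [Set.indicator_of_mem hxs, Set.indicator_of_mem (show S j x ∈ sideᶜ from hx.mpr hxs),
          hx']
        ring
      · rw [Set.indicator_of_notMem hxs, Set.indicator_of_notMem]
        exact fun h => hxs (hx.mp h)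
    simp only [mul_sub]
    rw [integral_sub (hFhS j).integrableOn (hFh j).integrableOn, h1,
      ← integral_add_compl measurableSet_side (hFh j)]
    ring
  rw [Finset.sum_congr rfl fun j _ => key j, Finset.sum_neg_distrib, ← integral_finsetSum _
    fun j _ => hFh j, neg_eq_zero]
  refine integral_eq_zero_of_ae ?_
  filter_upwards [hF.sum_eq_zero] with x hx
  rw [← Finset.sum_mul, hx, zero_mul, Pi.zero_apply]

theorem measurable_dipole (m : ℕ) (v w : Seq) : Measurable (dipole m v w) :=
  (measurable_one.indicator (measurableSet_cyl m v)).sub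
    (measurable_one.indicator (measurableSet_cyl m w))

theorem IsSystem.abs_integral_dipole_le (hS : IsSystem S) (hF : IsFlow S F) (i : Fin d) {m : ℕ}
    {v w : Seq} (hv : v ∈ side) (hw : w ∈ side) (hvw : ¬ Agree m v w) {δ : ℝ} (hδ : 0 < δ) :
    |∫ x in side, F i x * dipole m v w x ∂mu| ≤
      δ * ∑ j, ((∫ x in side, F j x ^ 2 ∂mu) + 1) := by
  -- Accuracy δ² is chosen for the inequality |ab| ≤ δa² + δ⁻¹b² used below: the second term then
  -- contributes at most δ.
  obtain ⟨h, hm, ⟨C, hC⟩, hh⟩ := hS.approx i m v w hv hw hvw (δ ^ 2) (by positivity)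
  have hFi : ∀ j, Integrable (F j) mu := fun j => (hF.memLp j).integrable (by norm_num)
  let e : Fin d → Seq → ℝ := fun j x => h (S j x) - h x - if j = i then dipole m v w x else 0
  have hem : ∀ j, Measurable (e j) := fun j => by
    refine ((hm.comp (hS.measurePreserving j).measurable).sub hm).sub ?_
    by_cases hj : j = i
    · simpa [hj] using measurable_dipole m v w
    · simp [hj]
  have heC : ∀ j x, |e j x| ≤ 2 * C + 1 := fun j x => by
    have h1 := abs_le.mp (hC (S j x))
    have h2 := abs_le.mp (hC x)
    have h3 := abs_le.mp (abs_dipole_le m v w x)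
    refine abs_le.mpr ?_
    simp only [e]
    split_ifs <;> constructor <;> linarith
  have hFe : ∀ j, Integrable (fun x => F j x * e j x) mu := fun j =>
    (hFi j).mul_bdd (hem j).aestronglyMeasurable (Eventually.of_forall (heC j))
  have hee : ∀ j, Integrable (fun x => e j x ^ 2) mu := fun j =>
    Integrable.of_bound ((hem j).pow_const 2).aestronglyMeasurable ((2 * C + 1) ^ 2)
      (Eventually.of_forall fun x => by
        rw [Real.norm_eq_abs, abs_pow]
        exact pow_le_pow_left₀ (abs_nonneg _) (heC j x) 2)
  have hFd : ∀ j, Integrable (fun x => F j x * if j = i then dipole m v w x else 0) mu := by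
    intro j
    by_cases hj : j = i
    · simp only [hj, if_true]
      exact (hFi i).mul_bdd (measurable_dipole m v w).aestronglyMeasurable
        (Eventually.of_forall fun x => abs_dipole_le m v w x)
    · simp [hj]
  have hsum : ∫ x in side, F i x * dipole m v w x ∂mu = -∑ j, ∫ x in side, F j x * e j x ∂mu := by
    have h0 := hS.sum_integral_gradient hF hm hC
    have h1 : ∀ j, ∫ x in side, F j x * (h (S j x) - h x) ∂mu = ∫ x in side, F j x * e j x ∂mu +
        ∫ x in side, F j x * (if j = i then dipole m v w x else 0) ∂mu := fun j => by
      rw [← integral_add (hFe j).integrableOn (hFd j).integrableOn]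
      refine integral_congr_ae (Eventually.of_forall fun x => ?_)
      simp only [e]
      ring
    rw [Finset.sum_congr rfl fun j _ => h1 j, Finset.sum_add_distrib] at h0
    have h2 : ∑ j, ∫ x in side, F j x * (if j = i then dipole m v w x else 0) ∂mu =
        ∫ x in side, F i x * dipole m v w x ∂mu := by
      rw [Finset.sum_eq_single i (fun j _ hj => by simp [hj]) (by simp)]
      simp
    linarith
  rw [hsum, abs_neg, Finset.mul_sum]
  refine (Finset.abs_sum_le_sum_abs _ _).trans (Finset.sum_le_sum fun j _ => ?_)
  have hF2 : Integrable (fun x => F j x ^ 2) mu := (hF.memLp j).integrable_sq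
  calc |∫ x in side, F j x * e j x ∂mu|
      ≤ ∫ x in side, |F j x * e j x| ∂mu := abs_integral_le_integral_abs
    _ ≤ ∫ x in side, (δ * F j x ^ 2 + δ⁻¹ * e j x ^ 2) ∂mu := by
        refine integral_mono (hFe j).abs.integrableOn
          ((hF2.const_mul δ).add ((hee j).const_mul δ⁻¹)).integrableOn fun x => ?_
        have h1 : δ * F j x ^ 2 + δ⁻¹ * e j x ^ 2 =
            δ⁻¹ * ((δ * |F j x|) ^ 2 + |e j x| ^ 2) := by
          rw [mul_pow, sq_abs, sq_abs]; field_simp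
        have h2 : |F j x * e j x| = δ⁻¹ * (δ * |F j x| * |e j x|) := by
          rw [abs_mul]; field_simp
        simp only [h1, h2]
        refine mul_le_mul_of_nonneg_left ?_ (by positivity)
        nlinarith [sq_nonneg (δ * |F j x| - |e j x|), sq_nonneg (δ * |F j x|), sq_nonneg |e j x|]
    _ = δ * (∫ x in side, F j x ^ 2 ∂mu) + δ⁻¹ * ∫ x in side, e j x ^ 2 ∂mu := by
        rw [integral_add (hF2.const_mul δ).integrableOn ((hee j).const_mul δ⁻¹).integrableOn,
          integral_const_mul, integral_const_mul]
    _ ≤ δ * (∫ x in side, F j x ^ 2 ∂mu) + δ⁻¹ * δ ^ 2 := by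
        gcongr
        exact hh j
    _ = _ := by field_simp

/-- Letting δ tend to 0 in the previous bound makes `F i` orthogonal to all dipoles, so its integral
over a cylinder in `side` depends only on the order. -/
theorem IsSystem.exists_const (hS : IsSystem S) (hF : IsFlow S F) :
    ∃ c : Fin d → ℝ, ∀ i, ∀ᵐ x ∂mu, x ∈ side → F i x = c i := by
  have hFi : ∀ j, Integrable (F j) mu := fun j => (hF.memLp j).integrable (by norm_num)
  have key : ∀ i, ∃ c, ∀ᵐ x ∂mu, x ∈ side → F i x = c := by
    refine fun i => exists_eq_const_of_setIntegral_cyl (hFi i) fun m v hv w hw => ?_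
    by_cases hvw : Agree m v w
    · rw [cyl_eq_of_agree hvw]
    have hz : ∫ x in side, F i x * dipole m v w x ∂mu = 0 := by
      rw [← abs_nonpos_iff]
      have ht : Tendsto (fun δ : ℝ => δ * ∑ j, ((∫ x in side, F j x ^ 2 ∂mu) + 1)) (𝓝[>] 0)
          (𝓝 0) := by
        refine tendsto_nhdsWithin_of_tendsto_nhds ?_
        exact Continuous.tendsto' (by fun_prop) _ _ (by simp)
      refine ge_of_tendsto ht ?_
      filter_upwards [self_mem_nhdsWithin] with δ hδ
      exact hS.abs_integral_dipole_le hF i hv hw hvw hδ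
    have hcyl : ∀ u ∈ side, ∫ x in cyl m u, F i x ∂mu =
        ∫ x in side, (cyl m u).indicator (F i) x ∂mu := fun u hu => by
      rw [setIntegral_indicator (measurableSet_cyl m u),
        Set.inter_eq_right.mpr (cyl_subset_side hu)]
    rw [hcyl v hv, hcyl w hw, ← sub_eq_zero, ← integral_sub
      ((hFi i).indicator (measurableSet_cyl _ _)).integrableOn
      ((hFi i).indicator (measurableSet_cyl _ _)).integrableOn, ← hz]
    refine integral_congr_ae (Eventually.of_forall fun x => ?_)
    by_cases h1 : x ∈ cyl m v <;> by_cases h2 : x ∈ cyl m w <;> simp [dipole, h1, h2]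
  choose c hc using key
  exact ⟨c, hc⟩

end

/-! ### Closed walks and freeness -/

theorem perm_apply_inv {α : Type*} (e : Equiv.Perm α) (x : α) : e (e⁻¹ x) = x :=
  e.apply_symm_apply x

theorem perm_inv_apply {α : Type*} (e : Equiv.Perm α) (x : α) : e⁻¹ (e x) = x :=
  e.symm_apply_apply x

variable {d : ℕ}

/-- The composition of the involutions along a walk with the colors `c 0, …, c (k - 1)`. -/
def walk (S : Fin d → Equiv.Perm Seq) (c : ℕ → Fin d) : ℕ → Equiv.Perm Seq
  | 0 => 1
  | k + 1 => S (c k) * walk S c k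

theorem walk_add (S : Fin d → Equiv.Perm Seq) (c : ℕ → Fin d) (j k : ℕ) :
    walk S c (j + k) = walk S (fun l => c (j + l)) k * walk S c j := by
  induction k with
  | zero => rfl
  | succ k ih => rw [← add_assoc, walk, ih, walk, mul_assoc]

theorem walk_congr (S : Fin d → Equiv.Perm Seq) {c c' : ℕ → Fin d} {k : ℕ}
    (h : ∀ j < k, c j = c' j) : walk S c k = walk S c' k := by
  induction k with
  | zero => rfl
  | succ k ih => rw [walk, walk, ih fun j hj => h j (by omega), h k (by omega)]

section

variable {S : Fin d → Equiv.Perm Seq}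

theorem IsSystem.inv_eq (hS : IsSystem S) (i : Fin d) : (S i)⁻¹ = S i :=
  inv_eq_of_mul_eq_one_left (Equiv.ext (hS.invol i))

theorem IsSystem.measurePreserving_walk (hS : IsSystem S) (c : ℕ → Fin d) (k : ℕ) :
    MeasurePreserving (walk S c k) mu mu := by
  induction k with
  | zero => exact MeasurePreserving.id mu
  | succ k ih => exact (hS.measurePreserving _).comp ih

theorem IsSystem.measurePreserving_walk_inv (hS : IsSystem S) (c : ℕ → Fin d) (k : ℕ) :
    MeasurePreserving ((walk S c k)⁻¹ : Equiv.Perm Seq) mu mu := by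
  induction k with
  | zero => exact MeasurePreserving.id mu
  | succ k ih =>
    rw [walk, mul_inv_rev, hS.inv_eq]
    exact ih.comp (hS.measurePreserving _)

theorem mu_side_ne_zero : mu side ≠ 0 := by
  rw [side, mu_coord]
  simp

/-- The constant value on `side` must be 0, since otherwise the support would contain almost all of
`side`. Antisymmetry carries this to the other side. -/
theorem IsSystem.eq_zero_of_small_support (hS : IsSystem S) {F : Fin d → Seq → ℝ}
    (hF : IsFlow S F) (i : Fin d) (hsupp : mu {x | F i x ≠ 0} < mu side) :
    ∀ᵐ x ∂mu, F i x = 0 := by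
  obtain ⟨c, hc⟩ := hS.exists_const hF
  have hc0 : c i = 0 := by
    by_contra hne
    refine hsupp.not_ge (measure_mono_ae ?_)
    filter_upwards [hc i] with x hx hxs
    change F i x ≠ 0
    rwa [hx hxs]
  filter_upwards [hc i, (hS.measurePreserving i).quasiMeasurePreserving.ae (hc i),
    hS.mem_side_iff i, hF.antisymm i] with x h1 h2 h3 h4
  by_cases hx : x ∈ side
  · rw [h1 hx, hc0]
  · rw [h2 (not_not.mp fun h => hx (h3.mp h)), hc0] at h4
    linarith

/-- The flow of a unit along the walks with the colors `c 0, …, c (l - 1)` which start in `A`. -/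
noncomputable def walkFlow (S : Fin d → Equiv.Perm Seq) (c : ℕ → Fin d) (l : ℕ) (A : Set Seq)
    (i : Fin d) (x : Seq) : ℝ :=
  ∑ k ∈ Finset.range l, if c k = i then
    A.indicator 1 ((walk S c k)⁻¹ x) - A.indicator 1 ((walk S c (k + 1))⁻¹ x) else 0

/-- The sum over the colors telescopes to the walks starting at x minus those ending at x, which
cancel because every walk from A is closed. Antisymmetry holds since `S i` exchanges the two ends of
a step of color i. -/
theorem IsSystem.isFlow_walkFlow (hS : IsSystem S) (c : ℕ → Fin d) (l : ℕ) {A : Set Seq}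
    (hA : MeasurableSet A) (hfix : ∀ x ∈ A, walk S c l x = x) : IsFlow S (walkFlow S c l A) where
  memLp i := by
    refine memLp_finsetSum _ fun k _ => ?_
    by_cases hk : c k = i
    · simp only [hk, if_true]
      have h : ∀ j, MemLp (fun x => A.indicator (1 : Seq → ℝ) ((walk S c j)⁻¹ x)) 2 mu := fun j =>
        (memLp_indicator_const 2 hA (1 : ℝ) (Or.inr (measure_ne_top mu A))).comp_measurePreserving
          (hS.measurePreserving_walk_inv c j)
      exact (h k).sub (h (k + 1))
    · simp [hk]
  sum_eq_zero := Eventually.of_forall fun x => by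
    unfold walkFlow
    rw [Finset.sum_comm]
    simp only [Finset.sum_ite_eq, Finset.mem_univ, if_true]
    rw [Finset.sum_range_sub', sub_eq_zero]
    have : x ∈ A ↔ (walk S c l)⁻¹ x ∈ A := by
      constructor
      · intro hx
        rwa [Equiv.Perm.inv_eq_iff_eq.mpr (hfix x hx).symm]
      · intro hx
        have := hfix _ hx
        rw [perm_apply_inv] at this
        rwa [this]
    by_cases hx : x ∈ A
    · rw [Set.indicator_of_mem (this.mp hx), show (walk S c 0)⁻¹ x = x from rfl,
        Set.indicator_of_mem hx]
      rfl
    · rw [Set.indicator_of_notMem (fun h => hx (this.mpr h)), show (walk S c 0)⁻¹ x = x from rfl,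
        Set.indicator_of_notMem hx]
  antisymm i := Eventually.of_forall fun x => by
    unfold walkFlow
    rw [← Finset.sum_neg_distrib]
    refine Finset.sum_congr rfl fun k _ => ?_
    split_ifs with hk
    · have h1 : (walk S c (k + 1))⁻¹ (S i x) = (walk S c k)⁻¹ x := by
        rw [walk, hk, mul_inv_rev, Equiv.Perm.mul_apply, perm_inv_apply]
      have h2 : (walk S c k)⁻¹ (S i x) = (walk S c (k + 1))⁻¹ x := by
        rw [walk, hk, mul_inv_rev, Equiv.Perm.mul_apply, hS.inv_eq]
      rw [h1, h2]
      ring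
    · simp

theorem IsSystem.mu_support_walkFlow_le (hS : IsSystem S) (c : ℕ → Fin d) (l : ℕ) {A : Set Seq}
    (hA : MeasurableSet A) (i : Fin d) :
    mu {x | walkFlow S c l A i x ≠ 0} ≤ (l + 1 : ℕ) * mu A := by
  have hsub : {x | walkFlow S c l A i x ≠ 0} ⊆
      ⋃ k ∈ Finset.range (l + 1), ((walk S c k)⁻¹ : Equiv.Perm Seq) ⁻¹' A := by
    intro x hx
    by_contra hne
    simp only [Set.mem_iUnion, Set.mem_preimage, not_exists, Finset.mem_range] at hne
    refine hx (Finset.sum_eq_zero fun k hk => ?_)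
    rw [Finset.mem_range] at hk
    rw [Set.indicator_of_notMem (hne k (by omega)),
      Set.indicator_of_notMem (hne (k + 1) (by omega))]
    simp
  refine (measure_mono hsub).trans ((measure_biUnion_finset_le _ _).trans ?_)
  rw [Finset.sum_congr rfl fun k _ =>
    (hS.measurePreserving_walk_inv c k).measure_preimage hA.nullMeasurableSet]
  simp

theorem exists_mass_lt (l : ℕ) : ∃ M, ∀ n, M ≤ n → (l + 1 : ℕ) * mass n < mu side := by
  have h : Tendsto (fun n : ℕ => ((l + 1 : ℕ) : ℝ≥0∞) * (2⁻¹ : ℝ≥0∞) ^ n) atTop (𝓝 0) := by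
    simpa using ENNReal.Tendsto.const_mul
      (ENNReal.tendsto_pow_atTop_nhds_zero_of_lt_one (by simp : (2⁻¹ : ℝ≥0∞) < 1))
      (Or.inr (ENNReal.natCast_ne_top (l + 1)))
  obtain ⟨M, hM⟩ := eventually_atTop.mp (h.eventually (gt_mem_nhds (pos_iff_ne_zero.mpr
    mu_side_ne_zero)))
  refine ⟨M, fun n hn => lt_of_le_of_lt ?_ (hM n hn)⟩
  gcongr
  rw [ENNReal.inv_pow.symm]
  exact mass_le n

theorem exists_not_agree {x y : Seq} (h : x ≠ y) : ∃ n, ¬ Agree n x y := by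
  by_contra! hn
  exact h (funext fun k => hn k k le_rfl)

/-- By strong induction on the length. Since shorter reduced walks have almost no fixed points, a
closed walk of length l almost surely visits its second vertex z only at time 1. Restricting to
walks whose second vertex is in a small cylinder around z gives a flow with small support, hence
zero, which nevertheless has value 1 on the edge leaving z with color `c 1`. -/
theorem IsSystem.ae_walk_ne (hS : IsSystem S) (l : ℕ) (hl : 0 < l) (c : ℕ → Fin d)
    (hc : ∀ k, k + 1 < l → c k ≠ c (k + 1)) : ∀ᵐ x ∂mu, walk S c l x ≠ x := by
  induction l using Nat.strong_induction_on generalizing c with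
  | _ l ih =>
  have hone : ∀ᵐ x ∂mu, walk S c 1 x ≠ x := by
    filter_upwards [hS.mem_side_iff (c 0)] with x hx h
    have h' : S (c 0) x = x := h
    rw [h'] at hx
    exact (iff_not_self hx.symm).elim
  obtain rfl | hl2 : l = 1 ∨ 1 < l := by omega
  · exact hone
  -- Time 1 is used rather than time 0 because the first and last colors of a reduced walk may
  -- coincide, whereas the two colors at time 1 differ.
  have hne : ∀ j, j ≤ l → j ≠ 1 → ∀ᵐ x ∂mu, walk S c j x ≠ walk S c 1 x := by
    intro j hj hj1
    obtain rfl | hj0 := j.eq_zero_or_pos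
    · filter_upwards [hone] with x hx h
      exact hx h.symm
    · have := ih (j - 1) (by omega) (by omega) (fun k => c (1 + k)) fun k hk => by
        rw [show 1 + (k + 1) = (1 + k) + 1 by ring]
        exact hc _ (by omega)
      filter_upwards [(hS.measurePreserving_walk c 1).quasiMeasurePreserving.ae this] with x hx h
      refine hx ?_
      have e : walk S c j = walk S (fun k => c (1 + k)) (j - 1) * walk S c 1 := by
        rw [← walk_add, Nat.add_sub_cancel' hj0]
      rwa [e, Equiv.Perm.mul_apply] at h
  have hsep : ∀ᵐ z ∂mu, ∀ j, j ≤ l → j ≠ 1 → walk S c 1 ((walk S c j)⁻¹ z) ≠ z := by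
    refine ae_all_iff.mpr fun j => ?_
    by_cases hj : j ≤ l ∧ j ≠ 1
    · filter_upwards [(hS.measurePreserving_walk_inv c j).quasiMeasurePreserving.ae
        (hne j hj.1 hj.2)] with z hz _ _ h
      rw [perm_apply_inv] at hz
      exact hz h.symm
    · exact Eventually.of_forall fun z h h' => absurd ⟨h, h'⟩ hj
  obtain ⟨M₀, hM₀⟩ := exists_mass_lt l
  let A : (M : ℕ) → Word M → Set Seq := fun M p =>
    {x | walk S c l x = x} ∩ walk S c 1 ⁻¹' cyl M p.extend
  have hA : ∀ M p, MeasurableSet (A M p) := fun M p =>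
    (measurableSet_eq_fun (hS.measurePreserving_walk c l).measurable measurable_id).inter
      ((hS.measurePreserving_walk c 1).measurable (measurableSet_cyl _ _))
  have hflow : ∀ᵐ z ∂mu, ∀ M, M₀ ≤ M → ∀ p : Word M, walkFlow S c l (A M p) (c 1) z = 0 := by
    refine ae_all_iff.mpr fun M => ?_
    by_cases hM : M₀ ≤ M
    · simp only [hM, true_imp_iff]
      refine ae_all_iff.mpr fun p => ?_
      refine hS.eq_zero_of_small_support (hS.isFlow_walkFlow c l (hA M p) fun x hx => hx.1) _ ?_
      refine lt_of_le_of_lt (hS.mu_support_walkFlow_le c l (hA M p) _) (lt_of_le_of_lt ?_ (hM₀ M hM))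
      gcongr
      refine (measure_mono Set.inter_subset_right).trans_eq ?_
      rw [(hS.measurePreserving_walk c 1).measure_preimage
        (measurableSet_cyl _ _).nullMeasurableSet, mu_cyl]
    · exact Eventually.of_forall fun z h => absurd h hM
  filter_upwards [(hS.measurePreserving_walk c 1).quasiMeasurePreserving.ae hflow,
    (hS.measurePreserving_walk c 1).quasiMeasurePreserving.ae hsep] with x hx hx' hfix
  set z := walk S c 1 x with hz
  have hex : ∀ j, ∃ n, j ≤ l → j ≠ 1 → ¬ Agree n (walk S c 1 ((walk S c j)⁻¹ z)) z := by
    intro j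
    by_cases hj : j ≤ l ∧ j ≠ 1
    · obtain ⟨n, hn⟩ := exists_not_agree (hx' j hj.1 hj.2)
      exact ⟨n, fun _ _ => hn⟩
    · exact ⟨0, fun h h' => absurd ⟨h, h'⟩ hj⟩
  choose n hn using hex
  -- This order makes the support small and also separates z from the second vertices of all walks
  -- that would be at z at another time.
  let M := max M₀ ((Finset.range (l + 1)).sup n)
  obtain ⟨p, hp⟩ := exists_word M z
  have hmem : ∀ j, j ≤ l → j ≠ 1 → (walk S c j)⁻¹ z ∉ A M p := by
    intro j hj hj1 h
    have hnM : n j ≤ M :=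
      (Finset.le_sup (f := n) (Finset.mem_range.mpr (Nat.lt_succ_of_le hj))).trans (le_max_right _ _)
    exact hn j hj hj1 ((Agree.trans h.2 hp).mono hnM)
  have hmem1 : (walk S c 1)⁻¹ z ∈ A M p := by
    rw [hz, perm_inv_apply]
    exact ⟨hfix, hp.symm⟩
  have hsum : walkFlow S c l (A M p) (c 1) z = 1 := by
    rw [walkFlow, Finset.sum_eq_single 1]
    · rw [if_pos rfl, Set.indicator_of_mem hmem1, Set.indicator_of_notMem (hmem 2 hl2 (by omega))]
      simp
    · intro k hk hk1
      rw [Finset.mem_range] at hk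
      obtain rfl | hk0 := k.eq_zero_or_pos
      -- Step 0 arrives at z, but with a color other than `c 1`.
      · exact if_neg (hc 0 hl2)
      · rw [Set.indicator_of_notMem (hmem k hk.le hk1),
          Set.indicator_of_notMem (hmem (k + 1) hk (by omega))]
        simp
    · exact fun h => absurd (Finset.mem_range.mpr hl2) h
  rw [hx M (le_max_left _ _) p] at hsum
  exact zero_ne_one hsum

end

end Tower

/-! ### Homomorphisms from the free product -/

namespace FreeProdZ2

theorem eq_one_or_eq_ofAdd (a : Multiplicative (ZMod 2)) : a = 1 ∨ a = Multiplicative.ofAdd 1 := by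
  revert a; decide

/-- The homomorphism from the two-element group given by an involution. -/
def involHom {G : Type*} [Group G] (e : G) (he : e * e = 1) : Multiplicative (ZMod 2) →* G where
  toFun a := if a = 1 then 1 else e
  map_one' := if_pos rfl
  map_mul' a b := by
    have h : (Multiplicative.ofAdd (1 : ZMod 2)) ≠ 1 := by decide
    have h' : Multiplicative.ofAdd (1 : ZMod 2) * Multiplicative.ofAdd 1 = 1 := by decide
    obtain rfl | rfl := eq_one_or_eq_ofAdd a <;> obtain rfl | rfl := eq_one_or_eq_ofAdd b <;>
      simp only [h, h', he, mul_one, one_mul, if_true, if_false]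

theorem exists_hom {G : Type*} [Group G] {d : ℕ} (e : Fin d → G) (he : ∀ i, e i * e i = 1) :
    ∃ φ : FreeProdZ2 d →* G, ∀ i, φ (gen i) = e i := by
  refine ⟨Monoid.CoprodI.lift fun i => involHom (e i) (he i), fun i => ?_⟩
  rw [gen, Monoid.CoprodI.lift_of]
  change (if Multiplicative.ofAdd (1 : ZMod 2) = 1 then 1 else e i) = e i
  exact if_neg (by decide)

instance (d : ℕ) : Countable (FreeProdZ2 d) := by
  have h : Function.Injective
      (Monoid.CoprodI.Word.toList (M := fun _ : Fin d => Multiplicative (ZMod 2))) :=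
    fun _ _ => Monoid.CoprodI.Word.ext
  have : Countable (Multiplicative (ZMod 2)) := Finite.to_countable
  have := h.countable
  exact (Monoid.CoprodI.Word.equiv (M := fun _ : Fin d => Multiplicative (ZMod 2))).injective.countable

end FreeProdZ2

/-! ### From involutions to the graphing -/

namespace Tower

open Filter Topology FreeProdZ2

variable {d : ℕ} [MulAction (FreeProdZ2 d) Seq] {S : Fin d → Equiv.Perm Seq}

theorem exists_walk (hact : ∀ i x, (gen i : FreeProdZ2 d) • x = S i x) (hd : 0 < d)
    (g : FreeProdZ2 d) : ∃ (l : ℕ) (c : ℕ → Fin d), (∀ k, k + 1 < l → c k ≠ c (k + 1)) ∧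
      (∀ x : Seq, g • x = walk S c l x) ∧ (l = 0 → g = 1) := by
  -- Each factor has a single nontrivial element, so a reduced word is a list of colors. Its first
  -- letter acts last, hence has index `c (l - 1)`; recording it keeps the walk reduced when a
  -- letter is prepended.
  suffices h : ∀ w : Monoid.CoprodI.Word (fun _ : Fin d => Multiplicative (ZMod 2)),
      ∃ (l : ℕ) (c : ℕ → Fin d), (∀ k, k + 1 < l → c k ≠ c (k + 1)) ∧
        (∀ x : Seq, w.prod • x = walk S c l x) ∧ (l = 0 → w.prod = 1) ∧
        (0 < l → w.fstIdx = some (c (l - 1))) by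
    obtain ⟨l, c, h1, h2, h3, -⟩ := h (Monoid.CoprodI.Word.equiv g)
    have e : (Monoid.CoprodI.Word.equiv g).prod = g := Monoid.CoprodI.Word.equiv.symm_apply_apply g
    rw [e] at h2 h3
    exact ⟨l, c, h1, h2, h3⟩
  intro w
  induction w using Monoid.CoprodI.Word.consRecOn with
  | empty =>
    exact ⟨0, fun _ => ⟨0, hd⟩, by simp, fun x => by
      rw [Monoid.CoprodI.Word.prod_empty, one_smul]; rfl, by simp, by simp⟩
  | cons i m w h1 h2 ih =>
    obtain ⟨l, c, hc, hx, -, hl⟩ := ih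
    obtain rfl := (eq_one_or_eq_ofAdd m).resolve_left h2
    refine ⟨l + 1, Function.update c l i, fun k hk => ?_, fun x => ?_, by simp, fun _ => ?_⟩
    · rw [Function.update_of_ne (by omega)]
      by_cases hkl : k + 1 = l
      · subst hkl
        rw [Function.update_self]
        intro h
        rw [hl (Nat.succ_pos k), Nat.add_sub_cancel, h] at h1
        exact h1 rfl
      · rw [Function.update_of_ne hkl]
        exact hc k (by omega)
    · rw [Monoid.CoprodI.Word.prod_cons, mul_smul, hx, walk, Function.update_self,
        walk_congr S (c := Function.update c l i) (c' := c) fun j hj => Function.update_of_ne (by omega) _ _]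
      exact hact i _
    · rw [Monoid.CoprodI.Word.fstIdx_cons, Nat.add_sub_cancel, Function.update_self]

theorem IsSystem.isEssFreePMPAction (hS : IsSystem S)
    (hact : ∀ i x, (gen i : FreeProdZ2 d) • x = S i x) (hd : 0 < d) :
    IsEssFreePMPAction (FreeProdZ2 d) mu where
  isProbabilityMeasure := inferInstance
  measurePreserving g := by
    obtain ⟨l, c, -, h, -⟩ := exists_walk hact hd g
    rw [funext h]
    exact hS.measurePreserving_walk c l
  essentially_free := by
    refine ae_all_iff.mpr fun g => ?_
    obtain ⟨l, c, hc, h, h0⟩ := exists_walk hact hd g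
    obtain rfl | hl := l.eq_zero_or_pos
    · exact Eventually.of_forall fun _ _ => h0 rfl
    · filter_upwards [hS.ae_walk_ne l hl c hc] with x hx hgx
      rw [h] at hgx
      exact absurd hgx hx

/-- Points where the involutions behave as everywhere in the definition of the graph. -/
structure IsRegular (S : Fin d → Equiv.Perm Seq) (x : Seq) : Prop where
  side_iff : ∀ i, S i x ∉ side ↔ x ∈ side
  injective : Function.Injective fun i => S i x

omit [MulAction (FreeProdZ2 d) Seq] in
theorem IsRegular.ne {x : Seq} (hx : IsRegular S x) (i : Fin d) : x ≠ S i x := by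
  intro h
  have := hx.side_iff i
  rw [← h] at this
  exact iff_not_self this.symm

theorem IsSystem.ae_isRegular (hS : IsSystem S)
    (hact : ∀ i x, (gen i : FreeProdZ2 d) • x = S i x) (hd : 0 < d) :
    ∀ᵐ x ∂mu, IsRegular S x := by
  filter_upwards [ae_all_iff.mpr hS.mem_side_iff,
    (hS.isEssFreePMPAction hact hd).essentially_free] with x hx hfree
  refine ⟨hx, fun i j hij => gen_injective (inv_mul_eq_one.mp (hfree ((gen i)⁻¹ * gen j) ?_))⟩
  rw [mul_smul, inv_smul_eq_iff, hact, hact]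
  exact hij.symm

theorem IsRegular.adj_iff (hact : ∀ i x, (gen i : FreeProdZ2 d) • x = S i x) {x : Seq}
    (hx : IsRegular S x) (y : Seq) : (graph d Seq).Adj x y ↔ ∃ i, y = S i x := by
  rw [graph_adj]
  simp only [hact]
  exact ⟨fun h => h.2, fun ⟨i, hi⟩ => ⟨hi ▸ hx.ne i, i, hi⟩⟩

theorem IsRegular.finsum_neighborSet (hact : ∀ i x, (gen i : FreeProdZ2 d) • x = S i x) {x : Seq}
    (hx : IsRegular S x) (f : Seq → ℝ) :
    ∑ᶠ y ∈ (graph d Seq).neighborSet x, f y = ∑ i, f (S i x) := by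
  have : (graph d Seq).neighborSet x = Set.range fun i => S i x := by
    ext y
    rw [SimpleGraph.mem_neighborSet, hx.adj_iff hact, Set.mem_range]
    simp only [eq_comm]
  rw [this, finsum_mem_range hx.injective, finsum_eq_sum_of_fintype]

theorem IsRegular.mem_colorClass_iff (hact : ∀ i x, (gen i : FreeProdZ2 d) • x = S i x) {x : Seq}
    (hx : IsRegular S x) (i j : Fin d) : (x, S j x) ∈ colorClass Seq i ↔ j = i := by
  simp only [colorClass, Set.mem_ofPred_eq, hact]
  exact ⟨fun h => hx.injective h.2, fun h => ⟨hx.ne j, by rw [h]⟩⟩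

omit [MulAction (FreeProdZ2 d) Seq] in
theorem IsSystem.measurableEmbedding (hS : IsSystem S) (i : Fin d) :
    MeasurableEmbedding fun x => (x, S i x) :=
  Measurable.measurableEmbedding (measurable_id.prodMk (hS.measurePreserving i).measurable)
    fun _ _ h => congrArg Prod.fst h

theorem edgeMeasure_eq (hact : ∀ i x, (gen i : FreeProdZ2 d) • x = S i x) :
    edgeMeasure d (mu : Measure Seq) = (d : ℝ≥0∞)⁻¹ • ∑ i, mu.map fun x => (x, S i x) := by
  simp only [edgeMeasure, hact]

theorem IsSystem.ae_edgeMeasure_iff (hS : IsSystem S)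
    (hact : ∀ i x, (gen i : FreeProdZ2 d) • x = S i x) {p : Seq × Seq → Prop} :
    (∀ᵐ e ∂edgeMeasure d (mu : Measure Seq), p e) ↔ ∀ i, ∀ᵐ x ∂mu, p (x, S i x) := by
  rw [edgeMeasure_eq hact, Measure.ae_ennreal_smul_measure_iff (by simp),
    ae_finsetSum_measure_iff]
  simp only [Finset.mem_univ, true_imp_iff, (hS.measurableEmbedding _).ae_map_iff]

theorem IsSystem.memLp_of_edgeMeasure (hS : IsSystem S)
    (hact : ∀ i x, (gen i : FreeProdZ2 d) • x = S i x) (hd : 0 < d) {f : Seq × Seq → ℝ}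
    (hf : MemLp f 2 (edgeMeasure d (mu : Measure Seq))) (i : Fin d) :
    MemLp (fun x => f (x, S i x)) 2 mu := by
  refine (hS.measurableEmbedding i).memLp_map_measure_iff.mp
    (hf.of_measure_le_smul (ENNReal.natCast_ne_top d) ?_)
  rw [edgeMeasure_eq hact, smul_smul, ENNReal.mul_inv_cancel (by simpa using hd.ne') (by simp),
    one_smul]
  exact Finset.single_le_sum (f := fun i => mu.map fun x => (x, S i x))
    (fun _ _ => Measure.zero_le _) (Finset.mem_univ i)

theorem isFiniteMeasure_edgeMeasure (hact : ∀ i x, (gen i : FreeProdZ2 d) • x = S i x)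
    (hd : 0 < d) : IsFiniteMeasure (edgeMeasure d (mu : Measure Seq)) := by
  rw [edgeMeasure_eq hact]
  exact Measure.smul_finite _ (ENNReal.inv_ne_top.mpr (by simpa using hd.ne'))

theorem IsSystem.measurableSet_colorClass (hS : IsSystem S)
    (hact : ∀ i x, (gen i : FreeProdZ2 d) • x = S i x) (i : Fin d) :
    MeasurableSet (colorClass (d := d) Seq i) := by
  simp only [colorClass, hact]
  exact (measurableSet_eq_fun measurable_fst measurable_snd).compl.inter
    (measurableSet_eq_fun measurable_snd ((hS.measurePreserving i).measurable.comp measurable_fst))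

/-- The sign of the side of a point. -/
noncomputable def sign (x : Seq) : ℝ := by
  classical exact if x ∈ side then 1 else -1

theorem sign_of_mem {x : Seq} (hx : x ∈ side) : sign x = 1 := if_pos hx

theorem sign_of_notMem {x : Seq} (hx : x ∉ side) : sign x = -1 := if_neg hx

theorem abs_sign (x : Seq) : |sign x| = 1 := by
  unfold sign
  split_ifs <;> simp

theorem measurable_sign : Measurable sign :=
  Measurable.ite measurableSet_side measurable_const measurable_const

omit [MulAction (FreeProdZ2 d) Seq] in
theorem IsRegular.sign_eq {x : Seq} (hx : IsRegular S x) (i : Fin d) : sign (S i x) = -sign x := by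
  by_cases h : x ∈ side
  · rw [sign_of_mem h, sign_of_notMem ((hx.side_iff i).mpr h)]
  · rw [sign_of_notMem h, sign_of_mem (not_not.mp fun h' => h ((hx.side_iff i).mp h')), neg_neg]

theorem IsRegular.genCirculation_apply (hact : ∀ i x, (gen i : FreeProdZ2 d) • x = S i x) {x : Seq}
    (hx : IsRegular S x) (i j : Fin d) :
    genCirculation side i (x, S j x) = sign x * if j = i then 1 else -1 / ((d : ℝ) - 1) := by
  simp only [genCirculation, hx.mem_colorClass_iff hact, sign]

theorem IsSystem.isMeasurableBipartition (hS : IsSystem S)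
    (hact : ∀ i x, (gen i : FreeProdZ2 d) • x = S i x) (hd : 0 < d) :
    IsMeasurableBipartition (graph d Seq) mu side := by
  refine ⟨measurableSet_side, ?_⟩
  filter_upwards [hS.ae_isRegular hact hd] with x hx y hxy
  obtain ⟨i, rfl⟩ := (hx.adj_iff hact y).mp hxy
  exact (hx.side_iff i).symm

theorem IsSystem.isL2Circulation_genCirculation (hS : IsSystem S)
    (hact : ∀ i x, (gen i : FreeProdZ2 d) • x = S i x) (hd : 1 < d) (i : Fin d) :
    IsL2Circulation (graph d Seq) mu (edgeMeasure d mu) (genCirculation side i) where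
  memLp := by
    classical
    have := isFiniteMeasure_edgeMeasure hact (by omega)
    refine MemLp.of_bound (Measurable.aestronglyMeasurable ?_) (max 1 |-1 / ((d : ℝ) - 1)|)
      (Eventually.of_forall fun p => ?_)
    · exact (Measurable.ite (measurable_fst measurableSet_side) measurable_const
        measurable_const).mul (Measurable.ite (hS.measurableSet_colorClass hact i) measurable_const
          measurable_const)
    · rw [genCirculation, Real.norm_eq_abs, abs_mul]
      split_ifs <;> simp
  antisymm := by
    filter_upwards [hS.ae_isRegular hact (by omega)] with x hx y hxy
    obtain ⟨j, rfl⟩ := (hx.adj_iff hact y).mp hxy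
    have h : (S j x, x) ∈ colorClass Seq i ↔ (x, S j x) ∈ colorClass Seq i := by
      simp only [colorClass, Set.mem_ofPred_eq, hact]
      refine and_congr ne_comm ⟨fun h => ?_, fun h => ?_⟩
      · nth_rw 2 [h]; rw [hS.invol]
      · rw [h, hS.invol]
    have hs := hx.sign_eq j
    unfold sign at hs
    rw [genCirculation, genCirculation, hs, propext h, neg_mul]
  flow := by
    filter_upwards [hS.ae_isRegular hact (by omega)] with x hx
    rw [hx.finsum_neighborSet hact]
    simp only [hx.genCirculation_apply hact]
    rw [← Finset.mul_sum, Finset.sum_ite, Finset.sum_const, Finset.sum_const,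
      Finset.filter_eq' Finset.univ i, Finset.filter_ne' Finset.univ i]
    simp only [Finset.mem_univ, if_true, Finset.card_singleton, one_smul,
      Finset.card_erase_of_mem, Finset.card_univ, Fintype.card_fin, nsmul_eq_mul]
    have hd' : (d : ℝ) - 1 ≠ 0 := by
      have : (1 : ℝ) < d := by exact_mod_cast hd
      linarith
    rw [Nat.cast_sub hd.le, Nat.cast_one]
    field_simp
    ring

theorem IsSystem.isFlow_of_isL2Circulation (hS : IsSystem S)
    (hact : ∀ i x, (gen i : FreeProdZ2 d) • x = S i x) (hd : 0 < d) {f : Seq × Seq → ℝ}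
    (hf : IsL2Circulation (graph d Seq) mu (edgeMeasure d mu) f) :
    IsFlow S fun i x => f (x, S i x) where
  memLp := hS.memLp_of_edgeMeasure hact hd hf.memLp
  sum_eq_zero := by
    filter_upwards [hS.ae_isRegular hact hd, hf.flow] with x hx h
    rwa [hx.finsum_neighborSet hact] at h
  antisymm i := by
    filter_upwards [hS.ae_isRegular hact hd, hf.antisymm] with x hx h
    rw [hS.invol]
    exact h _ ((hx.adj_iff hact _).mpr ⟨i, rfl⟩)

omit [MulAction (FreeProdZ2 d) Seq] in
theorem exists_mem_side {p : Seq → Prop} (h : ∀ᵐ x ∂mu, p x) : ∃ x ∈ side, p x := by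
  by_contra! hne
  refine mu_side_ne_zero (measure_mono_null (fun x hx => ?_) (ae_iff.mp h))
  exact hne x hx

/-- The constants are those on `side`, and antisymmetry gives the opposite ones on the other side.
Their sum is read off at one generic point, which exists because `side` is not null. -/
theorem IsSystem.ae_eq_sign_mul (hS : IsSystem S)
    (hact : ∀ i x, (gen i : FreeProdZ2 d) • x = S i x) (hd : 0 < d) {F : Fin d → Seq → ℝ}
    (hF : IsFlow S F) : ∃ c : Fin d → ℝ, ∑ i, c i = 0 ∧ ∀ᵐ x ∂mu, ∀ i, F i x = sign x * c i := by
  obtain ⟨c, hc⟩ := hS.exists_const hF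
  refine ⟨c, ?_, ?_⟩
  · obtain ⟨x, hx, h1, h2⟩ := exists_mem_side ((ae_all_iff.mpr hc).and hF.sum_eq_zero)
    rw [← h2]
    exact Finset.sum_congr rfl fun i _ => (h1 i hx).symm
  · refine ae_all_iff.mpr fun i => ?_
    filter_upwards [hS.ae_isRegular hact hd, hc i,
      (hS.measurePreserving i).quasiMeasurePreserving.ae (hc i), hF.antisymm i] with x h1 h2 h3 h4
    by_cases hx : x ∈ side
    · rw [h2 hx, sign_of_mem hx, one_mul]
    · rw [h3 (not_not.mp fun h => hx ((h1.side_iff i).mp h))] at h4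
      rw [sign_of_notMem hx, h4]
      ring

theorem IsSystem.exists_eq_sum_genCirculation (hS : IsSystem S)
    (hact : ∀ i x, (gen i : FreeProdZ2 d) • x = S i x) (hd : 1 < d) {f : Seq × Seq → ℝ}
    (hf : IsL2Circulation (graph d Seq) mu (edgeMeasure d mu) f) :
    ∃ c : Fin d → ℝ, f =ᵐ[edgeMeasure d mu] fun p => ∑ i, c i * genCirculation side i p := by
  obtain ⟨c, hc0, hc⟩ :=
    hS.ae_eq_sign_mul hact (by omega) (hS.isFlow_of_isL2Circulation hact (by omega) hf)
  -- On an edge of color j the i-th generator circulation is `sign x` · d/(d - 1) · (δ - 1/d), where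
  -- δ is 1 if i = j and 0 otherwise. The factor (d - 1)/d normalizes it, and the terms with 1/d
  -- cancel as the constants have sum zero.
  refine ⟨fun i => ((d : ℝ) - 1) / d * c i, (hS.ae_edgeMeasure_iff hact).mpr fun j => ?_⟩
  filter_upwards [hS.ae_isRegular hact (by omega), hc] with x hx hcx
  have h1 : (1 : ℝ) < d := by exact_mod_cast hd
  have h2 : (d : ℝ) - 1 ≠ 0 := by linarith
  have h3 : (d : ℝ) ≠ 0 := by linarith
  simp only [hcx j, hx.genCirculation_apply hact]
  have h4 : ∀ i, ((d : ℝ) - 1) / d * c i * (sign x * if j = i then 1 else -1 / ((d : ℝ) - 1)) =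
      sign x * ((if j = i then c i else 0) - (d : ℝ)⁻¹ * c i) := fun i => by
    split_ifs
    · field_simp
    · field_simp
      ring
  rw [Finset.sum_congr rfl fun i _ => h4 i, ← Finset.mul_sum, Finset.sum_sub_distrib,
    ← Finset.mul_sum, hc0]
  simp

/-! ### Perfect matchings -/

theorem IsSystem.isMeasurablePerfectMatching_colorClass (hS : IsSystem S)
    (hact : ∀ i x, (gen i : FreeProdZ2 d) • x = S i x) (hd : 0 < d) (i : Fin d) :
    IsMeasurablePerfectMatching (graph d Seq) mu (colorClass Seq i) where
  measurableSet := hS.measurableSet_colorClass hact i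
  subset_edges x y h := graph_adj.mpr ⟨h.1, i, h.2⟩
  symm x y h := by
    refine ⟨h.1.symm, ?_⟩
    have h2 : y = (gen i : FreeProdZ2 d) • x := h.2
    change x = (gen i : FreeProdZ2 d) • y
    rw [h2, smul_smul, gen_mul_self, one_smul]
  perfect := by
    filter_upwards [hS.ae_isRegular hact hd] with x hx
    refine ⟨S i x, (hx.mem_colorClass_iff hact i i).mpr rfl, fun y hy => ?_⟩
    rw [← hact]
    exact hy.2

theorem IsSystem.colorClass_not_ae_eq (hS : IsSystem S)
    (hact : ∀ i x, (gen i : FreeProdZ2 d) • x = S i x) (hd : 0 < d) {i j : Fin d} (hij : i ≠ j) :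
    ¬ colorClass Seq i =ᵐ[edgeMeasure d (mu : Measure Seq)] colorClass Seq j := by
  intro h
  obtain ⟨x, -, hx, hx'⟩ := exists_mem_side
    ((hS.ae_isRegular hact hd).and ((hS.ae_edgeMeasure_iff hact).mp (eventuallyEq_set.mp h) i))
  rw [hx.mem_colorClass_iff hact, hx.mem_colorClass_iff hact] at hx'
  exact hij (hx'.mp rfl)

open Classical in
/-- The flow associated with a perfect matching. -/
noncomputable def matchingFlow (S : Fin d → Equiv.Perm Seq) (M : Set (Seq × Seq)) (i : Fin d)
    (x : Seq) : ℝ :=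
  sign x * ((if (x, S i x) ∈ M then 1 else 0) - (d : ℝ)⁻¹)

theorem IsRegular.exists_unique_color (hact : ∀ i x, (gen i : FreeProdZ2 d) • x = S i x) {x : Seq}
    (hx : IsRegular S x) {M : Set (Seq × Seq)} (hM : ∀ x y, (x, y) ∈ M → (graph d Seq).Adj x y)
    (h : ∃! y, (x, y) ∈ M) : ∃ i, ∀ j, (x, S j x) ∈ M ↔ j = i := by
  obtain ⟨y, hy, hu⟩ := h
  obtain ⟨i, rfl⟩ := (hx.adj_iff hact y).mp (hM _ _ hy)
  exact ⟨i, fun j => ⟨fun hj => hx.injective (hu _ hj), fun hj => hj ▸ hy⟩⟩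

/-- Exactly one of the d edges at almost every vertex is matched, so subtracting 1/d makes the sum
vanish; the sign of the side turns the symmetric indicator into an antisymmetric function. -/
theorem IsSystem.isFlow_matchingFlow (hS : IsSystem S)
    (hact : ∀ i x, (gen i : FreeProdZ2 d) • x = S i x) (hd : 0 < d) {M : Set (Seq × Seq)}
    (hM : IsMeasurablePerfectMatching (graph d Seq) mu M) : IsFlow S (matchingFlow S M) where
  memLp i := by
    refine MemLp.of_bound (Measurable.aestronglyMeasurable ?_) (1 + (d : ℝ)⁻¹)
      (Eventually.of_forall fun x => ?_)
    · exact measurable_sign.mul ((Measurable.ite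
        ((hS.measurableEmbedding i).measurable hM.measurableSet)
        measurable_const measurable_const).sub measurable_const)
    · rw [matchingFlow, Real.norm_eq_abs, abs_mul, abs_sign, one_mul]
      have : (0 : ℝ) ≤ (d : ℝ)⁻¹ := by positivity
      refine abs_le.mpr ?_
      split_ifs <;> constructor <;> linarith
  sum_eq_zero := by
    filter_upwards [hS.ae_isRegular hact hd, hM.perfect] with x hx hp
    obtain ⟨i, hi⟩ := hx.exists_unique_color hact hM.subset_edges hp
    have hd' : (d : ℝ) ≠ 0 := by exact_mod_cast hd.ne'
    simp only [matchingFlow, hi]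
    rw [← Finset.mul_sum, Finset.sum_sub_distrib]
    simp [hd']
  antisymm i := by
    filter_upwards [hS.ae_isRegular hact hd] with x hx
    have h : (S i x, x) ∈ M ↔ (x, S i x) ∈ M := ⟨hM.symm _ _, hM.symm _ _⟩
    rw [matchingFlow, matchingFlow, hS.invol, propext h, hx.sign_eq, neg_mul]

theorem IsSystem.exists_ae_eq_colorClass (hS : IsSystem S)
    (hact : ∀ i x, (gen i : FreeProdZ2 d) • x = S i x) (hd : 0 < d) {M : Set (Seq × Seq)}
    (hM : IsMeasurablePerfectMatching (graph d Seq) mu M) :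
    ∃ i : Fin d, M =ᵐ[edgeMeasure d (mu : Measure Seq)] colorClass Seq i := by
  classical
  obtain ⟨c, -, hc⟩ := hS.ae_eq_sign_mul hact hd (hS.isFlow_matchingFlow hact hd hM)
  have hval : ∀ᵐ x ∂mu, ∀ j, (if (x, S j x) ∈ M then (1 : ℝ) else 0) = c j + (d : ℝ)⁻¹ := by
    filter_upwards [hc] with x hx j
    have hs : sign x ≠ 0 := fun h => by simpa [h] using abs_sign x
    have := mul_left_cancel₀ hs (hx j)
    rw [← this]
    ring
  -- Whether the edge of color j at x is matched is almost surely independent of x, so a single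
  -- generic vertex determines the color.
  obtain ⟨x₀, -, hx₀, hp, hv⟩ :=
    exists_mem_side ((hS.ae_isRegular hact hd).and (hM.perfect.and hval))
  obtain ⟨i, hi⟩ := hx₀.exists_unique_color hact hM.subset_edges hp
  refine ⟨i, eventuallyEq_set.mpr ((hS.ae_edgeMeasure_iff hact).mpr fun j => ?_)⟩
  filter_upwards [hS.ae_isRegular hact hd, hval] with x hx hxv
  have h := (hxv j).trans (hv j).symm
  rw [hx.mem_colorClass_iff hact, ← hi j]
  by_cases h1 : (x, S j x) ∈ M <;> by_cases h2 : (x₀, S j x₀) ∈ M <;> simp [h1, h2] at h ⊢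

end Tower

theorem theorem4 (d : ℕ) (hd : 3 ≤ d) :
    ∃ (X : Type) (_ : MeasurableSpace X) (_ : StandardBorelSpace X) (μ : Measure X)
      (_ : MulAction (FreeProdZ2 d) X),
      IsEssFreePMPAction (FreeProdZ2 d) μ ∧
      -- the Schreier graphing is measurably bipartite, and the circulations of the generators
      -- are in `L²` and span the space of all `L²` circulations
      (∃ B : Set X, IsMeasurableBipartition (FreeProdZ2.graph d X) μ B ∧
        (∀ i : Fin d, IsL2Circulation (FreeProdZ2.graph d X) μ (FreeProdZ2.edgeMeasure d μ)
          (FreeProdZ2.genCirculation B i)) ∧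
        (∀ f : X × X → ℝ,
          IsL2Circulation (FreeProdZ2.graph d X) μ (FreeProdZ2.edgeMeasure d μ) f →
          ∃ c : Fin d → ℝ, f =ᵐ[FreeProdZ2.edgeMeasure d μ]
            fun p => ∑ i, c i * FreeProdZ2.genCirculation B i p)) ∧
      -- up to null sets there are exactly `d` measurable perfect matchings: the color classes
      (∀ i : Fin d, IsMeasurablePerfectMatching (FreeProdZ2.graph d X) μ
        (FreeProdZ2.colorClass X i)) ∧
      (∀ i j : Fin d, i ≠ j →
        ¬ FreeProdZ2.colorClass X i =ᵐ[FreeProdZ2.edgeMeasure d μ] FreeProdZ2.colorClass X j) ∧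
      (∀ M : Set (X × X), IsMeasurablePerfectMatching (FreeProdZ2.graph d X) μ M →
        ∃ i : Fin d, M =ᵐ[FreeProdZ2.edgeMeasure d μ] FreeProdZ2.colorClass X i) := by
  have hd0 : 0 < d := by omega
  have hd1 : 1 < d := by omega
  obtain ⟨S, h1, h2, h3, h4⟩ := Tower.exists_involutions hd0
  have hS : Tower.IsSystem S := ⟨h1, h2, h3, h4⟩
  -- The relations of the free product hold because each `S i` is an involution at every point.
  obtain ⟨φ, hφ⟩ := FreeProdZ2.exists_hom S fun i => Equiv.ext (h1 i)
  let act : MulAction (FreeProdZ2 d) Tower.Seq := MulAction.compHom Tower.Seq φ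
  have hact : ∀ i x, (FreeProdZ2.gen i : FreeProdZ2 d) • x = S i x := fun i x => by
    rw [← hφ i]
    rfl
  exact ⟨Tower.Seq, inferInstance, inferInstance, Tower.mu, act, hS.isEssFreePMPAction hact hd0,
    ⟨Tower.side, hS.isMeasurableBipartition hact hd0,
      hS.isL2Circulation_genCirculation hact hd1,
      fun f hf => hS.exists_eq_sum_genCirculation hact hd1 hf⟩,
    hS.isMeasurablePerfectMatching_colorClass hact hd0,
    fun i j hij => hS.colorClass_not_ae_eq hact hd0 hij,
    fun M hM => hS.exists_ae_eq_colorClass hact hd0 hM⟩
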